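/- Consider the massless scalar field (real or complex) in $1+1$ dimensions, reduced to its right-moving part, in the following two black-hole models. Each is described by the relation between the incoming coordinate $x$ and the outgoing coordinate $y\in\mathbb R$ (units in which the mass and the cosmological parameter are $1$): \[ x(y)=-e^{-y}\quad\text{(relativistic model)},\qquad x(y)=-\log(1+e^{-y})\quad\text{(CGHS model)}. \] The incoming field is $\phi(x)=\frac1{\sqrt{2\pi}}\int_0^\infty\frac{dk}{2k}\,[a(k)e^{-ikx}+b(k)^\dagger e^{ikx}]$ with $[a(k),a(k')^\dagger]=[b(k),b(k')^\dagger]=2k\,\delta(k-k')$ ($b=a$ for the real field; for the complex field $a$ and $b$ are independent), and the outgoing field is $\hat\phi(y)=\phi(x(y))$. For $\beta>0$ let \[ \hat W^{Th}_{\beta,in}(y,y')=\langle\hat\phi(y)\,\hat\phi(y')^\dagger\rangle_\beta \] be its two-point function in the incoming thermal state $\langle A\rangle_\beta=\mathrm{Tr}[e^{-\beta H_{in}}A]/\mathrm{Tr}[e^{-\beta H_{in}}]$, where $H_{in}$ is the free Hamiltonian (a quantum of momentum $k>0$ has energy $k$). This mean value is understood as a limit: the momenta are restricted to $\delta,2\delta,\dots,N\delta$,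 then $N\to\infty$, then $\delta\to0^+$. Let \[ W^{Th}_{\beta,out}(y,y')=-\frac1{4\pi}\log\Big\{\frac\beta\pi\sinh\Big[\frac\pi\beta\,(y'-y+i0^+)\Big]\Big\}. \] Two-point functions are kernels of sesquilinear functionals $W(f,h)=\int\!\!\int f(y)\,\overline{h(y')}\,W(y,y')\,dy\,dy'$, tested on functions of $\mathcal S_0(\mathbb R)=\{f\in\mathcal S(\mathbb R):\int f=0\}$. The relation $W(y,y')\approx V(y,y')$ if $y,y'\gg1$ means: for every $\varepsilon>0$ there is $R$ such that for all $f,h\in\mathcal S_0(\mathbb R)$ supported in $[R,\infty)$ the values $W(f,h)$ and $V(f,h)$ exist and $|W(f,h)-V(f,h)|\le\varepsilon\,\|f\|_{L^1}\|h\|_{L^1}$. The relation if $-y,-y'\gg1$ is the same with supports in $(-\infty,-R]$. **Theorem.** For both models and for all $\beta>0$, \[ \hat W^{Th}_{\beta,in}(y,y')\approx W^{Th}_{2\pi,out}(y,y')\qquad\text{if } y,y'\gg1 . \] Furthermore, for the CGHS model and for all $\beta>0$, \[ \hat W^{Th}_{\beta,in}(y,y')\approx W^{Th}_{\beta,out}(y,y')\qquad\text{if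 } -y,-y'\gg1 . \] -/

import Mathlib

noncomputable section

namespace BHThermal

open Filter Topology SchwartzMap

/-- The two black-hole models (in units where the mass and the cosmological parameter are `1`
and the origin of the incoming coordinates is at the pulse and at the horizon). -/
inductive Model
  | relativistic
  | cghs

/-- The incoming (right) coordinate `x` as a function of the outgoing coordinate `y`. -/
def Model.x : Model → ℝ → ℝ
  | .relativistic, y => -Real.exp (-y)
  | .cghs, y => -Real.log (1 + Real.exp (-y))

/-- The massless scalar field may be real (each particle is its own antiparticle) or complex. -/
inductive FieldType
  | real
  | complex

/-! ### Gibbs mean values for finitely many bosonic oscillators -/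

/-- Algebraic Fock space of finitely many bosonic modes `σ`: the span of the orthonormal
occupation-number vectors `|n⟩`, `n : σ → ℕ`. -/
abbrev Fock (σ : Type) : Type := (σ → ℕ) →₀ ℂ

/-- Annihilation operator `a_s |n⟩ = √(n_s) |n - e_s⟩`. -/
def annih {σ : Type} [DecidableEq σ] (s : σ) : Module.End ℂ (Fock σ) :=
  Finsupp.linearCombination ℂ fun n : σ → ℕ =>
    Finsupp.single (Function.update n s (n s - 1)) ((Real.sqrt (n s) : ℝ) : ℂ)

/-- Creation operator `a_s† |n⟩ = √(n_s + 1) |n + e_s⟩`. -/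
def creat {σ : Type} [DecidableEq σ] (s : σ) : Module.End ℂ (Fock σ) :=
  Finsupp.linearCombination ℂ fun n : σ → ℕ =>
    Finsupp.single (Function.update n s (n s + 1)) ((Real.sqrt (n s + 1) : ℝ) : ℂ)

/-- The Boltzmann factor `⟨n| exp (-β H) |n⟩`, where `H = ∑ s, ω s • a_s† a_s`. -/
def boltzmann {σ : Type} [Fintype σ] (β : ℝ) (ω : σ → ℝ) (n : σ → ℕ) : ℝ :=
  Real.exp (-β * ∑ s, ω s * n s)

/-- Gibbs mean value `Tr [exp (-β H) A] / Tr [exp (-β H)]`, the traces being computed in the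
orthonormal basis of occupation-number vectors, in which `H` is diagonal. -/
def gibbsMean {σ : Type} [Fintype σ] (β : ℝ) (ω : σ → ℝ) (A : Module.End ℂ (Fock σ)) : ℂ :=
  (∑' n : σ → ℕ, (boltzmann β ω n : ℂ) * (A (Finsupp.single n 1)) n) /
    ∑' n : σ → ℕ, (boltzmann β ω n : ℂ)

/-! ### The incoming field, smeared in the outgoing coordinate -/

/-- The Fourier transform at incoming momentum `k` of the incoming test function attached to the
outgoing test function `f`, that is `(2π)^(-1/2) ∫ f(y) exp (-i k x(y)) dy`. -/
def amplitude (m : Model) (f : 𝓢(ℝ, ℂ)) (k : ℝ) : ℂ :=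
  ((Real.sqrt (2 * Real.pi))⁻¹ : ℝ) *
    ∫ y : ℝ, f y * Complex.exp (-(Complex.I * (k : ℂ) * (m.x y : ℂ)))

/-- The positive momenta `δ, 2δ, …, N δ` of right-moving quanta in a box of length `2π / δ`,
with an ultraviolet cutoff. -/
def mom (δ : ℝ) {N : ℕ} (j : Fin N) : ℝ := ((j : ℝ) + 1) * δ

/-- The outgoing field in a box, smeared with an outgoing test function `f`. With
`φ(x) = ∑ k, (δ / 2k)^(1/2) (2π)^(-1/2) (a_k exp (-i k x) + b_k† exp (i k x))`,
it is `∫ f(y) φ(x(y)) dy`. Here `a_k`, `b_k` are the modes `p j`, `q j`. -/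
def smearedField {σ : Type} [DecidableEq σ] {N : ℕ} (p q : Fin N → σ) (m : Model) (δ : ℝ)
    (f : 𝓢(ℝ, ℂ)) : Module.End ℂ (Fock σ) :=
  ∑ j : Fin N, ((Real.sqrt (δ / (2 * mom δ j)) : ℝ) : ℂ) •
    (amplitude m f (mom δ j) • annih (p j) + amplitude m f (-mom δ j) • creat (q j))

/-- The adjoint of the smeared field. -/
def smearedFieldAdj {σ : Type} [DecidableEq σ] {N : ℕ} (p q : Fin N → σ) (m : Model) (δ : ℝ)
    (f : 𝓢(ℝ, ℂ)) : Module.End ℂ (Fock σ) :=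
  ∑ j : Fin N, ((Real.sqrt (δ / (2 * mom δ j)) : ℝ) : ℂ) •
    (star (amplitude m f (mom δ j)) • creat (p j) +
      star (amplitude m f (-mom δ j)) • annih (q j))

/-- Thermal mean value of `φ[f] φ[h]†` (fields smeared in the outgoing coordinate) at inverse
temperature `β`, in a box with `N` momenta of spacing `δ`. A real field has one oscillator for
each momentum (`b_k = a_k`), a complex field has two (particle and antiparticle). -/
def boxTwoPt (m : Model) (β δ : ℝ) (N : ℕ) (f h : 𝓢(ℝ, ℂ)) : FieldType → ℂ
  | .real =>
      gibbsMean β (fun j : Fin N => mom δ j)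
        (smearedField id id m δ f * smearedFieldAdj id id m δ h)
  | .complex =>
      gibbsMean β (Sum.elim (fun j : Fin N => mom δ j) (fun j : Fin N => mom δ j))
        (smearedField Sum.inl Sum.inr m δ f * smearedFieldAdj Sum.inl Sum.inr m δ h)

/-- A possibly partially defined sesquilinear functional of two test functions:
`W f h w` says that the value of `W` at `(f, h)` exists and is `w`. -/
abbrev TwoPt : Type := 𝓢(ℝ, ℂ) → 𝓢(ℝ, ℂ) → ℂ → Prop

/-- The outgoing two-point function for an incoming thermal state at inverse temperature `β`:
the mean value of `φ[f] φ[h]†` exists and equals `w`, as the limit of the Gibbs mean values when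
the ultraviolet cutoff is removed (`N → ∞`) and then the size of the box goes to infinity
(`δ → 0+`). -/
def thermalInTwoPt (t : FieldType) (m : Model) (β : ℝ) : TwoPt := fun f h w =>
  ∃ W : ℝ → ℂ, (∀ δ > 0, Tendsto (fun N : ℕ => boxTwoPt m β δ N f h t) atTop (𝓝 (W δ))) ∧
    Tendsto W (𝓝[>] 0) (𝓝 w)

/-! ### The outgoing thermal two-point function -/

/-- `-(1/4π) log {(β/π) sinh [(π/β) z]}`. For `0 < Im z < β` the argument of the logarithm lies
in the open upper half-plane, so the principal branch is analytic there. -/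
def thermalKernel (β : ℝ) (z : ℂ) : ℂ :=
  -(1 / (4 * (Real.pi : ℂ))) *
    Complex.log (((β / Real.pi : ℝ) : ℂ) * Complex.sinh (((Real.pi / β : ℝ) : ℂ) * z))

/-- The distribution with kernel `-(1/4π) log {(β/π) sinh [(π/β) (y' - y + i 0+)]}`, applied to
`f(y)` and to the complex conjugate of `h(y')`. -/
def thermalOutTwoPt (β : ℝ) : TwoPt := fun f h w =>
  Tendsto (fun ε : ℝ => ∫ y : ℝ, ∫ y' : ℝ,
      f y * star (h y') * thermalKernel β ((y' : ℂ) - (y : ℂ) + Complex.I * (ε : ℂ)))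
    (𝓝[>] 0) (𝓝 w)

/-! ### Asymptotic equality of kernels -/

/-- Schwartz functions whose Fourier transform vanishes at zero momentum. -/
def S0 : Set 𝓢(ℝ, ℂ) := {f | ∫ y : ℝ, f y = 0}

/-- The kernels of `W` and `V` on `S0 × S0` are asymptotically equal when both variables lie in
`region R` and `R → ∞`: on test functions supported there both functionals are defined, and
their difference is that of a kernel which is uniformly small. -/
def AsympEq (region : ℝ → Set ℝ) (W V : TwoPt) : Prop :=
  ∀ ε > 0, ∃ R : ℝ, ∀ f ∈ S0, ∀ h ∈ S0,
    Function.support f ⊆ region R → Function.support h ⊆ region R →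
      ∃ w v : ℂ, W f h w ∧ V f h v ∧ ‖w - v‖ ≤ ε * (∫ y : ℝ, ‖f y‖) * ∫ y : ℝ, ‖h y‖

/-- `W(y, y') ≈ V(y, y')` if `y, y' ≫ 1`. -/
def AsympEqAtTop (W V : TwoPt) : Prop := AsympEq (fun R => Set.Ici R) W V

/-- `W(y, y') ≈ V(y, y')` if `-y, -y' ≫ 1`. -/
def AsympEqAtBot (W V : TwoPt) : Prop := AsympEq (fun R => Set.Iic (-R)) W V

end BHThermal

end

noncomputable section

namespace BHThermal

open Filter Topology SchwartzMap MeasureTheory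

/-! In a box the Gibbs mean of `φ[f] φ[h]†` sees only diagonal matrix elements, so it is expressed
by Bose-Einstein occupation numbers and is a Riemann sum of `spectralDensity` (`boxTwoPt_eq`). The
limiting momentum integral splits into a vacuum part and a part proportional to `bose (β k)`. With
`s = x(y') - x(y)`, Frullani's integral turns the vacuum part into the kernel `-(1/4π) log s`, and
the other part is `-(1/4π) thermalShift β s` (`integral_vacuumDensity`, `integral_excitedDensity`).
Euler's product gives `s exp (thermalShift β s) = (β/π) sinh (π s/β)` (`mul_exp_thermalShift`): the
incoming state has the usual thermal kernel, evaluated at `s` instead of `y' - y`. Since `f` and `h`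
have zero integral, any term depending on only one of `y`, `y'` is invisible.

For `y, y' → ∞` the separation `s` tends to zero, and so does the shift, which is `O(s²)` for every
`β`. Up to a factor close to 1, `s` equals `e^{-y} - e^{-y'} = e^{-(y+y')/2} · 2 sinh ((y'-y)/2)`.
The logarithm of the exponential is invisible, and the hyperbolic sine is the thermal kernel at
`2π`. For CGHS at `-∞`, `x(y) = y - log (1 + e^y)` is nearly `y`, the ratio of the two hyperbolic
sines is close to 1, and the temperature is unchanged.

The limits in the box need amplitudes that are `O(k)` at zero, against the singularity `k⁻²`, and
`O(1 / log k)` at infinity (`exists_norm_amplitude_le_div_log`), so that a multiple of the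
decreasing integrable function `1 / (k log² k)`, shifted by `e`, dominates all Riemann sums. -/

/-! ### Gibbs sums and mean occupation numbers -/

theorem summable_prod_pi {σ : Type} [Fintype σ] (g : σ → ℕ → ℝ)
    (h0 : ∀ s n, 0 ≤ g s n) (hs : ∀ s, Summable (g s)) :
    Summable fun n : σ → ℕ => ∏ s, g s (n s) := by
  classical
  refine summable_of_sum_le (c := ∏ s, ∑' n, g s n)
    (fun n => Finset.prod_nonneg fun s _ => h0 s _) fun u => ?_
  -- Enclose the finite set in the product of its coordinate projections: over a product the sum
  -- factors into one-mode sums.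
  have hu : u ⊆ Fintype.piFinset fun s => u.image fun n => n s := by
    intro n hn
    simp only [Fintype.mem_piFinset, Finset.mem_image]
    exact fun s => ⟨n, hn, rfl⟩
  calc ∑ n ∈ u, ∏ s, g s (n s)
      ≤ ∑ n ∈ Fintype.piFinset fun s => u.image fun n => n s, ∏ s, g s (n s) :=
        Finset.sum_le_sum_of_subset_of_nonneg hu
          fun n _ _ => Finset.prod_nonneg fun s _ => h0 s _
    _ = ∏ s, ∑ k ∈ u.image fun n => n s, g s k := by rw [Finset.prod_univ_sum]
    _ ≤ ∏ s, ∑' n, g s n := Finset.prod_le_prod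
        (fun s _ => Finset.sum_nonneg fun n _ => h0 s n)
        fun s _ => (hs s).sum_le_tsum _ fun n _ => h0 s n

theorem boltzmann_eq_prod {σ : Type} [Fintype σ] (β : ℝ) (ω : σ → ℝ) (n : σ → ℕ) :
    boltzmann β ω n = ∏ s, Real.exp (-(β * ω s) * n s) := by
  rw [boltzmann, ← Real.exp_sum, Finset.mul_sum]
  congr 1
  exact Finset.sum_congr rfl fun s _ => by ring

theorem summable_boltzmann {σ : Type} [Fintype σ] {β : ℝ} {ω : σ → ℝ}
    (h : ∀ s, 0 < β * ω s) : Summable (boltzmann β ω) := by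
  simp_rw [funext (boltzmann_eq_prod β ω)]
  refine summable_prod_pi (fun s n => Real.exp (-(β * ω s) * n)) (fun s n => (Real.exp_pos _).le)
    fun s => ?_
  simpa using Real.summable_pow_mul_exp_neg_nat_mul 0 (h s)

theorem summable_number_boltzmann {σ : Type} [Fintype σ] {β : ℝ} {ω : σ → ℝ}
    (h : ∀ s, 0 < β * ω s) (s : σ) : Summable fun n : σ → ℕ => (n s : ℝ) * boltzmann β ω n := by
  classical
  -- The factor `n s` is absorbed into the one-mode series of `s`, so that the summand is again a
  -- product.
  have := summable_prod_pi
    (fun t (n : ℕ) => (if t = s then (n : ℝ) else 1) * Real.exp (-(β * ω t) * n))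
    (fun t n => by split_ifs <;> positivity) fun t => by
      split_ifs
      · simpa using Real.summable_pow_mul_exp_neg_nat_mul 1 (h t)
      · simpa using Real.summable_pow_mul_exp_neg_nat_mul 0 (h t)
  refine this.congr fun n => ?_
  rw [Finset.prod_mul_distrib, boltzmann_eq_prod]
  simp

/-- The Bose-Einstein mean occupation number. -/
def bose (u : ℝ) : ℝ := (Real.exp u - 1)⁻¹

theorem boltzmann_update_succ {σ : Type} [Fintype σ] [DecidableEq σ] (β : ℝ) (ω : σ → ℝ) (s : σ)
    (n : σ → ℕ) : boltzmann β ω (Function.update n s (n s + 1)) =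
      Real.exp (-(β * ω s)) * boltzmann β ω n := by
  rw [boltzmann, boltzmann, ← Real.exp_add]
  congr 1
  rw [Fintype.sum_eq_add_sum_compl s, Fintype.sum_eq_add_sum_compl s]
  rw [Finset.sum_congr rfl (g := fun t => ω t * n t) fun t ht => by
    rw [Function.update_of_ne (by simpa using ht)]]
  rw [Function.update_self]
  push_cast
  ring

/-- Terms with `n s = 0` do not contribute to the sum `M`, and raising `n s` by one multiplies the
Boltzmann factor by `exp (-β ω s)`. Hence `M = exp (-β ω s) (M + Z)`, which is solved for `M`. -/
theorem tsum_number_boltzmann {σ : Type} [Fintype σ] {β : ℝ} {ω : σ → ℝ}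
    (h : ∀ s, 0 < β * ω s) (s : σ) :
    ∑' n : σ → ℕ, (n s : ℝ) * boltzmann β ω n = bose (β * ω s) * ∑' n, boltzmann β ω n := by
  classical
  set M := ∑' n : σ → ℕ, (n s : ℝ) * boltzmann β ω n with hM
  set Z := ∑' n, boltzmann β ω n with hZ
  have hinj : Function.Injective fun n : σ → ℕ => Function.update n s (n s + 1) := by
    intro n m hnm
    funext t
    have ht := congrFun hnm t
    by_cases hts : t = s
    · subst hts; simpa using ht
    · simpa [Function.update_of_ne hts] using ht
  have hsupp : Function.support (fun n : σ → ℕ => (n s : ℝ) * boltzmann β ω n) ⊆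
      Set.range fun n : σ → ℕ => Function.update n s (n s + 1) := by
    intro n hn
    have hns : n s ≠ 0 := by
      intro h0
      simp [h0] at hn
    refine ⟨Function.update n s (n s - 1), ?_⟩
    simp [Nat.sub_add_cancel (Nat.one_le_iff_ne_zero.2 hns)]
  have key : M = Real.exp (-(β * ω s)) * (M + Z) := by
    rw [hM, hZ, ← (summable_number_boltzmann h s).tsum_add (summable_boltzmann h), ← tsum_mul_left,
      ← hinj.tsum_eq hsupp]
    refine tsum_congr fun n => ?_
    rw [boltzmann_update_succ, Function.update_self]
    push_cast
    ring
  have he : (1 : ℝ) < Real.exp (β * ω s) := by simpa using h s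
  rw [Real.exp_neg] at key
  have hp := Real.exp_pos (β * ω s)
  rw [bose]
  rw [eq_inv_mul_iff_mul_eq₀ (by linarith)]
  field_simp at key
  linarith

theorem tsum_boltzmann_pos {σ : Type} [Fintype σ] {β : ℝ} {ω : σ → ℝ}
    (h : ∀ s, 0 < β * ω s) : 0 < ∑' n, boltzmann β ω n :=
  (summable_boltzmann h).tsum_pos (fun _ => (Real.exp_pos _).le) 0 (Real.exp_pos _)

/-! ### Diagonal matrix elements and the box two-point function -/

section Ladder

variable {σ : Type} [DecidableEq σ]

theorem annih_single (s : σ) (n : σ → ℕ) (c : ℂ) : annih s (Finsupp.single n c) =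
    Finsupp.single (Function.update n s (n s - 1)) (c * ((Real.sqrt (n s) : ℝ) : ℂ)) := by
  simp [annih]

theorem creat_single (s : σ) (n : σ → ℕ) (c : ℂ) : creat s (Finsupp.single n c) =
    Finsupp.single (Function.update n s (n s + 1)) (c * ((Real.sqrt (n s + 1) : ℝ) : ℂ)) := by
  simp [creat]

theorem diag_annih_creat (s t : σ) (n : σ → ℕ) :
    (annih s (creat t (Finsupp.single n 1))) n = if s = t then (n t : ℂ) + 1 else 0 := by
  rw [creat_single, annih_single]
  split_ifs with hst
  · subst hst
    simp only [Function.update_self, Function.update_idem, Nat.add_sub_cancel,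
      Function.update_eq_self, Finsupp.single_eq_same, one_mul]
    push_cast
    rw [← Complex.ofReal_mul, Real.mul_self_sqrt (by positivity)]
    push_cast; rfl
  · rw [Finsupp.single_eq_of_ne]
    intro h
    have := congrFun h t
    rw [Function.update_of_ne (Ne.symm hst)] at this
    simp at this

theorem diag_creat_annih (s t : σ) (n : σ → ℕ) :
    (creat s (annih t (Finsupp.single n 1))) n = if s = t then (n t : ℂ) else 0 := by
  rw [annih_single, creat_single]
  -- At `n t = 0` the truncated subtraction in `annih` leaves `n` unchanged, but the coefficient
  -- `√0` kills the vector.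
  by_cases h0 : n t = 0
  · simp [h0]
  split_ifs with hst
  · subst hst
    have h1 : n s - 1 + 1 = n s := Nat.sub_add_cancel (Nat.one_le_iff_ne_zero.2 h0)
    have h2 : ((n s - 1 : ℕ) : ℝ) + 1 = n s := by exact_mod_cast h1
    simp only [Function.update_self, Function.update_idem, h1, h2,
      Function.update_eq_self, Finsupp.single_eq_same, one_mul]
    rw [← Complex.ofReal_mul, Real.mul_self_sqrt (by positivity)]
    push_cast; rfl
  · rw [Finsupp.single_eq_of_ne]
    intro h
    have := congrFun h t
    rw [Function.update_of_ne (Ne.symm hst)] at this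
    simp at this
    omega

theorem diag_annih_annih (s t : σ) (n : σ → ℕ) :
    (annih s (annih t (Finsupp.single n 1))) n = 0 := by
  rw [annih_single, annih_single]
  by_cases h0 : n t = 0
  · simp [h0]
  rw [Finsupp.single_eq_of_ne]
  intro h
  have := congrFun h t
  by_cases hst : t = s
  · subst hst
    simp at this
    omega
  · rw [Function.update_of_ne hst] at this
    simp at this
    omega

theorem diag_creat_creat (s t : σ) (n : σ → ℕ) :
    (creat s (creat t (Finsupp.single n 1))) n = 0 := by
  rw [creat_single, creat_single, Finsupp.single_eq_of_ne]
  intro h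
  have := congrFun h t
  by_cases hst : t = s
  · subst hst
    simp at this
    omega
  · rw [Function.update_of_ne hst] at this
    simp at this

/-- Products `a a` and `a† a†` change the total number of quanta, whatever the modes, and `a a†`,
`a† a` with distinct modes change the occupations. Only injectivity of `p` and of `q` separately is
used, so `p = q` (real field) is covered. -/
theorem diag_smearedField {N : ℕ} {p q : Fin N → σ} (hp : Function.Injective p)
    (hq : Function.Injective q) (m : Model) (δ : ℝ) (f h : 𝓢(ℝ, ℂ)) (n : σ → ℕ) :
    ((smearedField p q m δ f * smearedFieldAdj p q m δ h) (Finsupp.single n 1)) n =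
      ∑ j : Fin N, ((Real.sqrt (δ / (2 * mom δ j)) : ℝ) : ℂ) ^ 2 *
        (amplitude m f (mom δ j) * star (amplitude m h (mom δ j)) * ((n (p j) : ℂ) + 1) +
          amplitude m f (-mom δ j) * star (amplitude m h (-mom δ j)) * (n (q j) : ℂ)) := by
  simp only [smearedField, smearedFieldAdj, Module.End.mul_apply, LinearMap.sum_apply,
    LinearMap.smul_apply, LinearMap.add_apply, map_sum, map_smul, map_add, Finsupp.coe_finsetSum,
    Finset.sum_apply, Finsupp.smul_apply, Finsupp.add_apply, diag_annih_creat,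
    diag_creat_annih, diag_annih_annih, diag_creat_creat, hp.eq_iff, hq.eq_iff, smul_eq_mul]
  refine Finset.sum_congr rfl fun j _ => ?_
  simp only [mul_add, mul_ite, mul_zero, add_zero, zero_add,
    Finset.sum_ite_eq', Finset.mem_univ, if_true]
  ring

end Ladder

theorem gibbsMean_smearedField {σ : Type} [Fintype σ] [DecidableEq σ] {N : ℕ} {p q : Fin N → σ}
    (hp : Function.Injective p) (hq : Function.Injective q) (m : Model) (δ : ℝ) (f h : 𝓢(ℝ, ℂ))
    {β : ℝ} {ω : σ → ℝ} (hω : ∀ s, 0 < β * ω s) :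
    gibbsMean β ω (smearedField p q m δ f * smearedFieldAdj p q m δ h) =
      ∑ j : Fin N, ((Real.sqrt (δ / (2 * mom δ j)) : ℝ) : ℂ) ^ 2 *
        (amplitude m f (mom δ j) * star (amplitude m h (mom δ j)) * (1 + (bose (β * ω (p j)) : ℂ)) +
          amplitude m f (-mom δ j) * star (amplitude m h (-mom δ j)) * (bose (β * ω (q j)) : ℂ)) := by
  have hZ := (tsum_boltzmann_pos hω).ne'
  have hs0 : HasSum (fun n => (boltzmann β ω n : ℂ)) ((∑' n, boltzmann β ω n : ℝ) : ℂ) :=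
    Complex.hasSum_ofReal.2 (summable_boltzmann hω).hasSum
  have hs1 (s : σ) : HasSum (fun n : σ → ℕ => (n s : ℂ) * (boltzmann β ω n : ℂ))
      ((bose (β * ω s) * ∑' n, boltzmann β ω n : ℝ) : ℂ) := by
    rw [← tsum_number_boltzmann hω]
    exact_mod_cast Complex.hasSum_ofReal.2 (summable_number_boltzmann hω s).hasSum
  rw [gibbsMean, hs0.tsum_eq, div_eq_iff (by exact_mod_cast hZ), Finset.sum_mul]
  simp_rw [diag_smearedField hp hq, Finset.mul_sum]
  refine HasSum.tsum_eq (hasSum_sum fun j _ => ?_)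
  convert! (((hs1 (p j)).add hs0).mul_left (((Real.sqrt (δ / (2 * mom δ j)) : ℝ) : ℂ) ^ 2 *
    (amplitude m f (mom δ j) * star (amplitude m h (mom δ j))))).add
    ((hs1 (q j)).mul_left (((Real.sqrt (δ / (2 * mom δ j)) : ℝ) : ℂ) ^ 2 *
      (amplitude m f (-mom δ j) * star (amplitude m h (-mom δ j))))) using 1
  · funext n
    ring
  · push_cast
    ring

/-- The density of the thermal two-point function with respect to the momentum. -/
def spectralDensity (m : Model) (β : ℝ) (f h : 𝓢(ℝ, ℂ)) (k : ℝ) : ℂ :=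
  ((2 * k)⁻¹ : ℝ) *
    (amplitude m f k * star (amplitude m h k) * (1 + (bose (β * k) : ℂ)) +
      amplitude m f (-k) * star (amplitude m h (-k)) * (bose (β * k) : ℂ))

/-- The real and the complex field give the same sum: the surviving terms `a a†` and `b† b` have
means depending only on the energy of their mode. -/
theorem boxTwoPt_eq (t : FieldType) (m : Model) {β δ : ℝ} (hβ : 0 < β) (hδ : 0 < δ) (N : ℕ)
    (f h : 𝓢(ℝ, ℂ)) :
    boxTwoPt m β δ N f h t =
      ∑ j ∈ Finset.range N, (δ : ℂ) * spectralDensity m β f h (((j : ℝ) + 1) * δ) := by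
  have hm (j : Fin N) : 0 < mom δ j := by unfold mom; positivity
  have hsq (j : Fin N) : ((Real.sqrt (δ / (2 * mom δ j)) : ℝ) : ℂ) ^ 2 =
      (δ : ℂ) * ((2 * mom δ j)⁻¹ : ℝ) := by
    have := hm j
    rw [← Complex.ofReal_pow, Real.sq_sqrt (by positivity), div_eq_mul_inv]
    push_cast; rfl
  rw [Finset.sum_range fun j => (δ : ℂ) * spectralDensity m β f h (((j : ℝ) + 1) * δ)]
  cases t
  · rw [boxTwoPt, gibbsMean_smearedField Function.injective_id Function.injective_id m δ f h
      fun j => mul_pos hβ (hm j)]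
    refine Finset.sum_congr rfl fun j _ => ?_
    rw [hsq, spectralDensity, mul_assoc]
    rfl
  · rw [boxTwoPt, gibbsMean_smearedField Sum.inl_injective Sum.inr_injective m δ f h
      (by rintro (j | j) <;> exact mul_pos hβ (hm j))]
    refine Finset.sum_congr rfl fun j _ => ?_
    rw [hsq, spectralDensity, mul_assoc]
    rfl

/-! ### Coordinate maps and decay of the amplitudes -/

/-- The reciprocal of the derivative of `m.x`. -/
def Model.invSlope : Model → ℝ → ℝ
  | .relativistic, y => Real.exp y
  | .cghs, y => 1 + Real.exp y

theorem Model.invSlope_pos (m : Model) (y : ℝ) : 0 < m.invSlope y := by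
  cases m <;> simp only [Model.invSlope] <;> positivity

theorem Model.invSlope_le (m : Model) (y : ℝ) : m.invSlope y ≤ 1 + Real.exp y := by
  cases m <;> simp [Model.invSlope]

theorem Model.hasDerivAt_invSlope (m : Model) (y : ℝ) :
    HasDerivAt m.invSlope (Real.exp y) y := by
  cases m
  · exact Real.hasDerivAt_exp y
  · exact (Real.hasDerivAt_exp y).const_add 1

theorem Model.hasDerivAt_x (m : Model) (y : ℝ) : HasDerivAt m.x (m.invSlope y)⁻¹ y := by
  have h : HasDerivAt (fun y => Real.exp (-y)) (-Real.exp (-y)) y := by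
    simpa using (hasDerivAt_neg y).exp
  cases m
  · refine h.neg.congr_deriv ?_
    simp [Model.invSlope, Real.exp_neg]
  · refine ((h.const_add 1).log (by positivity)).neg.congr_deriv ?_
    simp only [Model.invSlope, Real.exp_neg]
    field_simp
    ring

theorem Model.continuous_x (m : Model) : Continuous m.x :=
  continuous_iff_continuousAt.2 fun y => (m.hasDerivAt_x y).continuousAt

theorem Model.continuous_invSlope (m : Model) : Continuous m.invSlope :=
  continuous_iff_continuousAt.2 fun y => (m.hasDerivAt_invSlope y).continuousAt

theorem Model.strictMono_x (m : Model) : StrictMono m.x :=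
  strictMono_of_hasDerivAt_pos m.hasDerivAt_x fun y => inv_pos.2 (m.invSlope_pos y)

/-- Test functions in `S0` on whose support the incoming coordinate grows at most linearly. -/
def Adapted (m : Model) (f : 𝓢(ℝ, ℂ)) : Prop :=
  ∫ y, f y = 0 ∧ ∃ C, ∀ y, f y ≠ 0 → |m.x y| ≤ C * (1 + |y|)

theorem integrable_weight (f : 𝓢(ℝ, ℂ)) (n : ℕ) :
    Integrable fun y => (1 + |y|) ^ n * ‖f y‖ := by
  simp_rw [add_comm (1 : ℝ), add_pow, one_pow, mul_one, Finset.sum_mul]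
  refine integrable_finsetSum _ fun i _ => ?_
  refine ((f.integrable_pow_mul volume i).const_mul (n.choose i : ℝ)).congr
    (.of_forall fun y => ?_)
  simp only [Real.norm_eq_abs]
  ring

theorem Adapted.norm_mul_le {m : Model} {f : 𝓢(ℝ, ℂ)} {C : ℝ}
    (h : ∀ y, f y ≠ 0 → |m.x y| ≤ C * (1 + |y|)) (y : ℝ) :
    |m.x y| * ‖f y‖ ≤ C * (1 + |y|) * ‖f y‖ := by
  by_cases hy : f y = 0
  · simp [hy]
  · gcongr
    exact h y hy

theorem Adapted.integrable_x_mul {m : Model} {f : 𝓢(ℝ, ℂ)} (hf : Adapted m f) :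
    Integrable fun y => |m.x y| * ‖f y‖ := by
  obtain ⟨-, C, hC⟩ := hf
  refine ((integrable_weight f 1).const_mul C).mono'
    (m.continuous_x.abs.mul f.continuous.norm).aestronglyMeasurable (.of_forall fun y => ?_)
  rw [Real.norm_of_nonneg (by positivity)]
  refine (Adapted.norm_mul_le hC y).trans_eq ?_
  ring

/-- The plane wave `exp (-i k x(y))`. -/
def wave (m : Model) (k y : ℝ) : ℂ := Complex.exp (-(Complex.I * (k : ℂ) * (m.x y : ℂ)))

theorem norm_wave (m : Model) (k y : ℝ) : ‖wave m k y‖ = 1 := by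
  rw [wave, show -(Complex.I * (k : ℂ) * (m.x y : ℂ)) = ((-(k * m.x y) : ℝ) : ℂ) * Complex.I by
    push_cast; ring, Complex.norm_exp_ofReal_mul_I]

theorem continuous_wave (m : Model) (k : ℝ) : Continuous (wave m k) := by
  have := m.continuous_x
  unfold wave
  fun_prop

theorem norm_wave_sub_one_le (m : Model) (k y : ℝ) : ‖wave m k y - 1‖ ≤ |k| * |m.x y| := by
  rw [wave, show -(Complex.I * (k : ℂ) * (m.x y : ℂ)) = Complex.I * ((-(k * m.x y) : ℝ) : ℂ) by
    push_cast; ring]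
  refine (Real.norm_exp_I_mul_ofReal_sub_one_le).trans_eq ?_
  rw [Real.norm_eq_abs, abs_neg, abs_mul]

theorem integrable_mul_wave (m : Model) (f : 𝓢(ℝ, ℂ)) (k : ℝ) :
    Integrable fun y => f y * wave m k y :=
  f.integrable.mono (f.continuous.mul (continuous_wave m k)).aestronglyMeasurable
    (.of_forall fun y => by simp [norm_wave])

theorem amplitude_eq (m : Model) (f : 𝓢(ℝ, ℂ)) (k : ℝ) :
    amplitude m f k = ((Real.sqrt (2 * Real.pi))⁻¹ : ℝ) * ∫ y, f y * wave m k y := rfl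

theorem inv_sqrt_two_pi_le_one : (Real.sqrt (2 * Real.pi))⁻¹ ≤ 1 := by
  refine inv_le_one_of_one_le₀ (Real.one_le_sqrt.2 ?_)
  linarith [Real.pi_gt_three]

theorem norm_amplitude_le (m : Model) (f : 𝓢(ℝ, ℂ)) (k : ℝ) :
    ‖amplitude m f k‖ ≤ ‖∫ y, f y * wave m k y‖ := by
  rw [amplitude_eq, norm_mul, Complex.norm_real, Real.norm_of_nonneg (by positivity)]
  exact mul_le_of_le_one_left (norm_nonneg _) inv_sqrt_two_pi_le_one

theorem continuous_amplitude (m : Model) (f : 𝓢(ℝ, ℂ)) : Continuous (amplitude m f) := by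
  refine continuous_const.mul (continuous_of_dominated (F := fun (k y : ℝ) => f y * wave m k y)
    (fun k => (integrable_mul_wave m f k).aestronglyMeasurable)
    (fun k => .of_forall fun y => (by rw [norm_mul, norm_wave, mul_one])) f.integrable.norm
    (.of_forall fun y => ?_))
  unfold wave
  fun_prop

theorem norm_amplitude_le_integral (m : Model) (f : 𝓢(ℝ, ℂ)) (k : ℝ) :
    ‖amplitude m f k‖ ≤ ∫ y, ‖f y‖ := by
  refine (norm_amplitude_le m f k).trans ((norm_integral_le_integral_norm _).trans_eq ?_)
  simp [norm_wave]

/-- Zero integral of `f` allows subtracting 1 from the plane wave, and `|e^{iθ} - 1| ≤ |θ|`. The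
factor `|k|` gained here cures the infrared singularity. -/
theorem Adapted.norm_amplitude_le {m : Model} {f : 𝓢(ℝ, ℂ)} (hf : Adapted m f) (k : ℝ) :
    ‖amplitude m f k‖ ≤ |k| * ∫ y, |m.x y| * ‖f y‖ := by
  refine (BHThermal.norm_amplitude_le m f k).trans ?_
  have : ∫ y, f y * wave m k y = ∫ y, f y * (wave m k y - 1) := by
    simp_rw [mul_sub, mul_one]
    rw [integral_sub (integrable_mul_wave m f k) f.integrable, hf.1, sub_zero]
  rw [this, ← integral_const_mul]
  refine norm_integral_le_of_norm_le (hf.integrable_x_mul.const_mul _) (.of_forall fun y => ?_)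
  rw [norm_mul]
  calc ‖f y‖ * ‖wave m k y - 1‖ ≤ ‖f y‖ * (|k| * |m.x y|) := by
        gcongr; exact norm_wave_sub_one_le m k y
    _ = |k| * (|m.x y| * ‖f y‖) := by ring

theorem hasDerivAt_wave (m : Model) (k y : ℝ) :
    HasDerivAt (wave m k) (-(Complex.I * k) * (wave m k y * ((m.invSlope y)⁻¹ : ℝ))) y := by
  have := (((m.hasDerivAt_x y).ofReal_comp.const_mul (Complex.I * (k : ℂ))).neg).cexp
  refine this.congr_deriv ?_
  rw [wave, Pi.neg_apply]
  ring

/-- Integration by parts: the wave is its own derivative divided by `-i k x'(y)`. The factor `1/x'`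
is at most `1 + e^T` on the half-line, which is the loss in the bound; `A` depends on neither `k`
nor `T`. -/
theorem norm_setIntegral_Iic_mul_wave_le (m : Model) (f : 𝓢(ℝ, ℂ)) :
    ∃ A, 0 ≤ A ∧ ∀ k T : ℝ, k ≠ 0 →
      ‖∫ y in Set.Iic T, f y * wave m k y‖ ≤ (1 + Real.exp T) * A / |k| := by
  obtain ⟨M, hM⟩ : ∃ M, ∀ y, ‖f y‖ ≤ M := ⟨_, fun y => f.norm_le_seminorm ℝ y⟩
  have hM0 : 0 ≤ M := (norm_nonneg _).trans (hM 0)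
  set f' : 𝓢(ℝ, ℂ) := SchwartzMap.derivCLM ℝ ℂ f with hf'
  have hd (y : ℝ) : HasDerivAt f (f' y) y := f.hasDerivAt y
  have hI : Integrable fun y => ‖f' y‖ + ‖f y‖ := f'.integrable.norm.add f.integrable.norm
  refine ⟨M + ∫ y, (‖f' y‖ + ‖f y‖), add_nonneg hM0 (integral_nonneg fun y => by positivity),
    fun k T hk => ?_⟩
  have hc : -(Complex.I * (k : ℂ)) ≠ 0 := by simp [hk]
  set u : ℝ → ℂ := fun y => f y * (m.invSlope y : ℝ) with hu
  set u' : ℝ → ℂ := fun y => f' y * (m.invSlope y : ℝ) + f y * (Real.exp y : ℝ) with hu'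
  set v : ℝ → ℂ := fun y => (-(Complex.I * (k : ℂ)))⁻¹ * wave m k y with hv
  set v' : ℝ → ℂ := fun y => wave m k y * ((m.invSlope y)⁻¹ : ℝ) with hv'
  have hud (y : ℝ) : HasDerivAt u (u' y) y := (hd y).mul (m.hasDerivAt_invSlope y).ofReal_comp
  have hvd (y : ℝ) : HasDerivAt v (v' y) y := by
    refine ((hasDerivAt_wave m k y).const_mul (-(Complex.I * (k : ℂ)))⁻¹).congr_deriv ?_
    rw [← mul_assoc, inv_mul_cancel₀ hc, one_mul]
  have huv (y : ℝ) : u y * v' y = f y * wave m k y := by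
    have : ((m.invSlope y : ℝ) : ℂ) ≠ 0 := by exact_mod_cast (m.invSlope_pos y).ne'
    simp only [hu, hv']
    push_cast
    field_simp
  have hvn (y : ℝ) : ‖v y‖ = |k|⁻¹ := by simp [hv, norm_wave]
  have hg (y : ℝ) (hy : y ≤ T) : m.invSlope y ≤ 1 + Real.exp T :=
    (m.invSlope_le y).trans (by gcongr)
  have hu'n (y : ℝ) (hy : y ≤ T) : ‖u' y‖ ≤ (1 + Real.exp T) * (‖f' y‖ + ‖f y‖) := by
    refine (norm_add_le _ _).trans ?_
    rw [norm_mul, norm_mul, Complex.norm_real, Complex.norm_real,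
      Real.norm_of_nonneg (m.invSlope_pos y).le, Real.norm_of_nonneg (Real.exp_pos y).le]
    have h1 := hg y hy
    have h2 : Real.exp y ≤ 1 + Real.exp T := by
      linarith [Real.exp_le_exp.2 hy]
    nlinarith [mul_le_mul_of_nonneg_left h1 (norm_nonneg (f' y)),
      mul_le_mul_of_nonneg_left h2 (norm_nonneg (f y))]
  have hun (y : ℝ) (hy : y ≤ T) : ‖u y‖ ≤ (1 + Real.exp T) * ‖f y‖ := by
    rw [hu, norm_mul, Complex.norm_real, Real.norm_of_nonneg (m.invSlope_pos y).le, mul_comm]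
    gcongr
    exact hg y hy
  have hcont : Continuous (u' * v) := by
    have h1 := f'.continuous
    have h2 := f.continuous
    have h3 := m.continuous_invSlope
    have h4 := continuous_wave m k
    simp only [hu', hv]
    refine Continuous.mul ?_ (by fun_prop)
    fun_prop
  have hbd (y : ℝ) (hy : y ≤ T) : ‖(u' * v) y‖ ≤
      (1 + Real.exp T) * |k|⁻¹ * (‖f' y‖ + ‖f y‖) := by
    rw [Pi.mul_apply, norm_mul, hvn]
    calc ‖u' y‖ * |k|⁻¹ ≤ (1 + Real.exp T) * (‖f' y‖ + ‖f y‖) * |k|⁻¹ := by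
          gcongr; exact hu'n y hy
      _ = _ := by ring
  have hibp := integral_Iic_mul_deriv_eq_deriv_mul (a := T) (u := u) (v := v) (u' := u') (v' := v')
    (a' := u T * v T) (b' := 0) (fun y _ => hud y) (fun y _ => hvd y)
    (by
      have := (integrable_mul_wave m f k).integrableOn (s := Set.Iic T)
      refine this.congr (.of_forall fun y => (huv y).symm))
    ((hI.const_mul _).integrableOn.mono' hcont.aestronglyMeasurable
      ((ae_restrict_iff' measurableSet_Iic).2 (.of_forall hbd)))
    (((hud T).continuousAt.mul (hvd T).continuousAt).tendsto.mono_left nhdsWithin_le_nhds)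
    (by
      have hf0 : Tendsto (fun y => (1 + Real.exp T) * ‖f y‖ * |k|⁻¹) atBot (𝓝 0) := by
        have : Tendsto f atBot (𝓝 0) :=
          (zero_at_infty f).mono_left atBot_le_cocompact
        simpa using (this.norm.const_mul (1 + Real.exp T)).mul_const |k|⁻¹
      refine squeeze_zero_norm' ?_ hf0
      filter_upwards [Filter.eventually_le_atBot T] with y hy
      rw [Pi.mul_apply, norm_mul, hvn]
      gcongr
      exact hun y hy)
  rw [setIntegral_congr_fun measurableSet_Iic fun y _ => (huv y).symm, hibp, sub_zero]
  refine (norm_sub_le _ _).trans ?_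
  have h1 : ‖u T * v T‖ ≤ (1 + Real.exp T) * M * |k|⁻¹ := by
    rw [norm_mul, hvn]
    gcongr
    refine (hun T le_rfl).trans ?_
    gcongr
    exact hM T
  have h2 : ‖∫ y in Set.Iic T, u' y * v y‖ ≤
      (1 + Real.exp T) * |k|⁻¹ * ∫ y, (‖f' y‖ + ‖f y‖) := by
    refine (norm_integral_le_of_norm_le (hI.const_mul _).integrableOn
      ((ae_restrict_iff' measurableSet_Iic).2 (.of_forall hbd))).trans ?_
    rw [← integral_const_mul]
    exact setIntegral_le_integral (hI.const_mul _) (.of_forall fun y => by positivity)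
  refine (add_le_add h1 h2).trans_eq ?_
  rw [div_eq_mul_inv]
  ring

theorem norm_setIntegral_Ioi_mul_wave_le (m : Model) (f : 𝓢(ℝ, ℂ)) (k : ℝ) {T : ℝ} (hT : 0 < T) :
    ‖∫ y in Set.Ioi T, f y * wave m k y‖ ≤ (∫ y, (1 + |y|) ^ 1 * ‖f y‖) / T := by
  have hI := (integrable_weight f 1).const_mul T⁻¹
  refine (norm_integral_le_of_norm_le hI.integrableOn
    ((ae_restrict_iff' measurableSet_Ioi).2 (.of_forall fun y hy => ?_))).trans
    ((setIntegral_le_integral hI (.of_forall fun y => by positivity)).trans_eq ?_)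
  · rw [norm_mul, norm_wave, mul_one, ← mul_assoc]
    refine le_mul_of_one_le_left (norm_nonneg _) ?_
    rw [inv_mul_eq_div, one_le_div hT, pow_one]
    have : T < y := hy
    linarith [le_abs_self y]
  · rw [integral_const_mul, inv_mul_eq_div]

/-- For large `y` the coordinate `x` is nearly constant and oscillation does not help, so the
integral is cut at `T = log |k| / 2`. Left of `T`, integration by parts gives about `√|k| / |k|`;
right of `T`, the first moment of `f` gives `O(1/T)`. -/
theorem exists_norm_amplitude_le_div_log (m : Model) (f : 𝓢(ℝ, ℂ)) :
    ∃ C, 0 ≤ C ∧ ∀ k : ℝ, ‖amplitude m f k‖ ≤ C / Real.log (|k| + Real.exp 1) := by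
  obtain ⟨A, hA, hA'⟩ := norm_setIntegral_Iic_mul_wave_le m f
  set B := ∫ y, (1 + |y|) ^ 1 * ‖f y‖
  have hB : 0 ≤ B := integral_nonneg fun y => by positivity
  set L := ∫ y, ‖f y‖
  have hL : 0 ≤ L := integral_nonneg fun y => by positivity
  -- The term `2 * L` serves `|k| ≤ e`, where the logarithm is at most 2; the terms `8 * A` and `4 *
  -- B` come from the two sides of the cut.
  refine ⟨8 * A + 4 * B + 2 * L, by positivity, fun k => ?_⟩
  have he : (2 : ℝ) < Real.exp 1 := by linarith [Real.exp_one_gt_d9]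
  have hlog1 : 1 ≤ Real.log (|k| + Real.exp 1) := by
    rw [Real.le_log_iff_exp_le (by positivity)]
    linarith [abs_nonneg k]
  rw [le_div_iff₀ (by linarith)]
  rcases le_total |k| (Real.exp 1) with hk | hk
  · have : Real.log (|k| + Real.exp 1) ≤ 2 := by
      rw [Real.log_le_iff_le_exp (by positivity), show (2 : ℝ) = 1 + 1 by norm_num, Real.exp_add]
      nlinarith
    nlinarith [norm_amplitude_le_integral m f k, norm_nonneg (amplitude m f k)]
  · have hk1 : 1 < |k| := by linarith
    have hlk : 1 ≤ Real.log |k| := by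
      rw [Real.le_log_iff_exp_le (by positivity)]; exact hk
    have hl2 : Real.log (|k| + Real.exp 1) ≤ 2 * Real.log |k| := by
      rw [← Real.log_rpow (by positivity)]
      refine Real.log_le_log (by positivity) ?_
      rw [Real.rpow_two]
      nlinarith
    set s := Real.sqrt |k| with hs
    have hs1 : 1 < s := by rw [hs]; exact Real.lt_sqrt_of_sq_lt (by simpa using hk1)
    have hss : s * s = |k| := Real.mul_self_sqrt (abs_nonneg k)
    have hls : Real.log |k| ≤ 2 * s := by
      rw [← hss, Real.log_mul (by positivity) (by positivity)]
      linarith [Real.log_le_sub_one_of_pos (show 0 < s by linarith)]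
    have heT : Real.exp (Real.log |k| / 2) = s := by
      rw [← Real.log_sqrt (abs_nonneg k), Real.exp_log (by positivity)]
    have h1 := hA' k (Real.log |k| / 2) (by intro h; simp [h] at hk1; linarith)
    have h2 := norm_setIntegral_Ioi_mul_wave_le m f k (T := Real.log |k| / 2) (by positivity)
    rw [heT] at h1
    have h3 : ‖amplitude m f k‖ ≤ (1 + s) * A / |k| + B / (Real.log |k| / 2) := by
      refine (norm_amplitude_le m f k).trans ?_
      have hsplit := integral_add_compl (measurableSet_Iic (a := Real.log |k| / 2))
        (integrable_mul_wave m f k)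
      rw [← hsplit, Set.compl_Iic]
      exact (norm_add_le _ _).trans (add_le_add h1 h2)
    have h4 : (1 + s) * A / |k| * Real.log |k| ≤ 4 * A := by
      rw [div_mul_eq_mul_div, div_le_iff₀ (by positivity)]
      have : (1 + s) * Real.log |k| ≤ 4 * |k| := by nlinarith
      nlinarith
    have h5 : B / (Real.log |k| / 2) * Real.log |k| = 2 * B := by
      field_simp
    calc ‖amplitude m f k‖ * Real.log (|k| + Real.exp 1)
        ≤ ((1 + s) * A / |k| + B / (Real.log |k| / 2)) * (2 * Real.log |k|) := by
          gcongr
      _ = 2 * ((1 + s) * A / |k| * Real.log |k|) + 2 * (B / (Real.log |k| / 2) * Real.log |k|) := by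
          ring
      _ ≤ _ := by rw [h5]; linarith

/-! ### Riemann sums on the half-line -/

section RiemannSum

theorem ceil_div_mul_mem {k δ : ℝ} (hk : 0 < k) (hδ : 0 < δ) :
    k ≤ ⌈k / δ⌉₊ * δ ∧ ⌈k / δ⌉₊ * δ ≤ k + δ := by
  constructor
  · rw [← div_le_iff₀ hδ]
    exact Nat.le_ceil _
  · have := (Nat.ceil_lt_add_one (div_pos hk hδ).le).le
    calc ⌈k / δ⌉₊ * δ ≤ (k / δ + 1) * δ := by gcongr
      _ = k + δ := by field_simp

variable {g : ℝ → ℂ} {G : ℝ → ℝ}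

/-- The sample point `⌈k/δ⌉ δ` is never left of `k`, so a decreasing majorant of `g` dominates the
step functions for all `δ` at once. -/
theorem norm_step_le (hgG : ∀ k > 0, ‖g k‖ ≤ G k) (hG : AntitoneOn G (Set.Ioi 0))
    {δ k : ℝ} (hδ : 0 < δ) (hk : 0 < k) : ‖g (⌈k / δ⌉₊ * δ)‖ ≤ G k := by
  have h := (ceil_div_mul_mem hk hδ).1
  exact (hgG _ (hk.trans_le h)).trans (hG hk (hk.trans_le h) h)

theorem measurable_step (g : ℝ → ℂ) (δ : ℝ) : Measurable fun k : ℝ => g (⌈k / δ⌉₊ * δ) :=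
  (measurable_from_nat (f := fun n : ℕ => g (n * δ))).comp
    (Nat.measurable_ceil.comp (measurable_id.div_const δ))

theorem integrableOn_step (hgG : ∀ k > 0, ‖g k‖ ≤ G k) (hG : AntitoneOn G (Set.Ioi 0))
    (hGi : IntegrableOn G (Set.Ioi 0)) {δ : ℝ} (hδ : 0 < δ) :
    IntegrableOn (fun k : ℝ => g (⌈k / δ⌉₊ * δ)) (Set.Ioi 0) :=
  hGi.mono' (measurable_step g δ).aestronglyMeasurable
    ((ae_restrict_iff' measurableSet_Ioi).2 (.of_forall fun _ hk => norm_step_le hgG hG hδ hk))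

theorem tendsto_sum_step (hgG : ∀ k > 0, ‖g k‖ ≤ G k) (hG : AntitoneOn G (Set.Ioi 0))
    (hGi : IntegrableOn G (Set.Ioi 0)) {δ : ℝ} (hδ : 0 < δ) :
    Tendsto (fun N : ℕ => ∑ j ∈ Finset.range N, (δ : ℂ) * g (((j : ℝ) + 1) * δ)) atTop
      (𝓝 (∫ k in Set.Ioi 0, g (⌈k / δ⌉₊ * δ))) := by
  have hi := integrableOn_step hgG hG hGi hδ
  have h := intervalIntegral_tendsto_integral_Ioi 0 hi
    ((tendsto_natCast_atTop_atTop (R := ℝ)).atTop_mul_const hδ)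
  refine h.congr fun N => ?_
  have hle (j : ℕ) : (j : ℝ) * δ ≤ ((j + 1 : ℕ) : ℝ) * δ := by
    gcongr; exact Nat.le_succ j
  have hsum := intervalIntegral.sum_integral_adjacent_intervals (μ := volume)
    (f := fun k : ℝ => g (⌈k / δ⌉₊ * δ)) (a := fun j : ℕ => (j : ℝ) * δ) (n := N) fun j _ => by
      rw [intervalIntegrable_iff_integrableOn_Ioc_of_le (hle j)]
      exact hi.mono_set fun k hk => lt_of_le_of_lt (by positivity) hk.1
  rw [Nat.cast_zero, zero_mul] at hsum
  rw [← hsum]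
  refine Finset.sum_congr rfl fun j _ => ?_
  have hc : ∫ k in (j * δ)..((j + 1 : ℕ) * δ), g (⌈k / δ⌉₊ * δ) =
      ∫ _ in (j * δ)..((j + 1 : ℕ) * δ), g (((j : ℝ) + 1) * δ) := by
    rw [intervalIntegral.integral_of_le (hle j), intervalIntegral.integral_of_le (hle j)]
    refine setIntegral_congr_fun measurableSet_Ioc fun k hk => ?_
    -- Cells are open on the left and closed on the right, matching momenta that start at `δ` rather
    -- than at 0.
    have : ⌈k / δ⌉₊ = j + 1 := by
      rw [Nat.ceil_eq_iff (Nat.succ_ne_zero j)]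
      refine ⟨?_, ?_⟩
      · rw [Nat.succ_sub_one, lt_div_iff₀ hδ]; exact hk.1
      · rw [div_le_iff₀ hδ]; exact hk.2
    simp [this]
  rw [hc, intervalIntegral.integral_const, Complex.real_smul]
  congr 1
  push_cast
  ring

theorem tendsto_integral_step (hg : ContinuousOn g (Set.Ioi 0)) (hgG : ∀ k > 0, ‖g k‖ ≤ G k)
    (hG : AntitoneOn G (Set.Ioi 0)) (hGi : IntegrableOn G (Set.Ioi 0)) :
    Tendsto (fun δ : ℝ => ∫ k in Set.Ioi 0, g (⌈k / δ⌉₊ * δ)) (𝓝[>] 0)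
      (𝓝 (∫ k in Set.Ioi 0, g k)) := by
  refine tendsto_integral_filter_of_dominated_convergence G
    (.of_forall fun δ => (measurable_step g δ).aestronglyMeasurable) ?_ hGi
    ((ae_restrict_iff' measurableSet_Ioi).2 (.of_forall fun k hk => ?_))
  · filter_upwards [self_mem_nhdsWithin] with δ hδ
    exact (ae_restrict_iff' measurableSet_Ioi).2 (.of_forall fun k hk => norm_step_le hgG hG hδ hk)
  · refine ((hg.continuousAt (Ioi_mem_nhds hk)).tendsto).comp ?_
    refine tendsto_of_tendsto_of_tendsto_of_le_of_le' (g := fun _ => k) (h := fun δ => k + δ)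
      tendsto_const_nhds ?_ ?_ ?_
    · have : Tendsto (fun δ : ℝ => k + δ) (𝓝 0) (𝓝 (k + 0)) := by
        exact (continuous_const.add continuous_id).tendsto 0
      rw [add_zero] at this
      exact this.mono_left nhdsWithin_le_nhds
    · filter_upwards [self_mem_nhdsWithin] with δ hδ using (ceil_div_mul_mem hk hδ).1
    · filter_upwards [self_mem_nhdsWithin] with δ hδ using (ceil_div_mul_mem hk hδ).2

end RiemannSum

/-! ### Integrable bounds for the vacuum and excited densities -/

/-- An integrable decreasing majorant of spectral densities. -/
def logMajorant (k : ℝ) : ℝ := (k + Real.exp 1)⁻¹ * (Real.log (k + Real.exp 1) ^ 2)⁻¹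

theorem one_le_log_add_exp {k : ℝ} (hk : 0 ≤ k) : 1 ≤ Real.log (k + Real.exp 1) := by
  rw [Real.le_log_iff_exp_le (by positivity)]
  linarith

theorem logMajorant_pos {k : ℝ} (hk : 0 ≤ k) : 0 < logMajorant k := by
  have := one_le_log_add_exp hk
  unfold logMajorant
  positivity

theorem antitoneOn_logMajorant : AntitoneOn logMajorant (Set.Ioi 0) := by
  intro a ha b hb hab
  have ha : 0 < a := ha
  have := one_le_log_add_exp ha.le
  unfold logMajorant
  gcongr

theorem integrableOn_logMajorant : IntegrableOn logMajorant (Set.Ioi 0) := by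
  -- `-1 / log (k + e)` is a primitive with a finite limit at infinity; the shift by `e` keeps the
  -- logarithm at least 1.
  have hd (k : ℝ) (hk : 0 ≤ k) :
      HasDerivAt (fun k => -(Real.log (k + Real.exp 1))⁻¹) (logMajorant k) k := by
    have h1 := one_le_log_add_exp hk
    have h2 : k + Real.exp 1 ≠ 0 := by positivity
    refine ((((hasDerivAt_id k).add_const (Real.exp 1)).log h2).inv
      (zero_lt_one.trans_le h1).ne').neg.congr_deriv ?_
    simp only [logMajorant, id, div_eq_mul_inv]
    ring
  refine integrableOn_Ioi_deriv_of_nonneg (l := -0) (hd 0 le_rfl).continuousAt.continuousWithinAt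
    (fun k hk => hd k (le_of_lt hk)) (fun k hk => (logMajorant_pos (le_of_lt hk)).le) ?_
  refine (tendsto_inv_atTop_zero.comp (Real.tendsto_log_atTop.comp ?_)).neg
  exact tendsto_atTop_add_const_right _ _ tendsto_id

/-- The weight serves both densities: `1/(2k)` for the vacuum, and `bose (β k) / (2k) ≤ 1/(2 β k²)`.
For `|k| ≤ 1` the two infrared factors `|k|` cancel `k⁻²`; for `|k| ≥ 1` the two inverse logarithms
produce `logMajorant`. -/
theorem exists_norm_amplitude_mul_le {m : Model} {f h : 𝓢(ℝ, ℂ)} (hf : Adapted m f)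
    (hh : Adapted m h) : ∃ C, 0 ≤ C ∧ ∀ k : ℝ, k ≠ 0 →
      ‖amplitude m f k * star (amplitude m h k)‖ * (|k|⁻¹ + (|k| ^ 2)⁻¹) ≤
        C * logMajorant |k| := by
  obtain ⟨A, hA, hA'⟩ := exists_norm_amplitude_le_div_log m f
  obtain ⟨B, hB, hB'⟩ := exists_norm_amplitude_le_div_log m h
  set P := ∫ y, |m.x y| * ‖f y‖
  set Q := ∫ y, |m.x y| * ‖h y‖
  have hP : 0 ≤ P := integral_nonneg fun y => by positivity
  have hQ : 0 ≤ Q := integral_nonneg fun y => by positivity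
  have h1 := logMajorant_pos (zero_le_one (α := ℝ))
  refine ⟨8 * (A * B) + 2 * (P * Q) / logMajorant 1, by positivity, fun k hk => ?_⟩
  have hk0 : 0 < |k| := abs_pos.2 hk
  have hm := logMajorant_pos hk0.le
  rw [norm_mul, norm_star]
  rcases le_total |k| 1 with hk1 | hk1
  · have hb : ‖amplitude m f k‖ * ‖amplitude m h k‖ ≤ (|k| * P) * (|k| * Q) := by
      gcongr
      exacts [hf.norm_amplitude_le k, hh.norm_amplitude_le k]
    have hl : logMajorant 1 ≤ logMajorant |k| := antitoneOn_logMajorant hk0 (Set.mem_Ioi.2 one_pos) hk1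
    calc _ ≤ (|k| * P) * (|k| * Q) * (|k|⁻¹ + (|k| ^ 2)⁻¹) := by gcongr
      _ = P * Q * (|k| + 1) := by field_simp
      _ ≤ P * Q * 2 := by gcongr; linarith
      _ = 2 * (P * Q) / logMajorant 1 * logMajorant 1 := by field_simp
      _ ≤ 2 * (P * Q) / logMajorant 1 * logMajorant |k| := by gcongr
      _ ≤ _ := by
        gcongr
        have := mul_nonneg hA hB
        linarith
  · have hlog := one_le_log_add_exp hk0.le
    have hb : ‖amplitude m f k‖ * ‖amplitude m h k‖ ≤
        (A / Real.log (|k| + Real.exp 1)) * (B / Real.log (|k| + Real.exp 1)) := by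
      gcongr
      exacts [hA' k, hB' k]
    have hi : |k|⁻¹ + (|k| ^ 2)⁻¹ ≤ 8 * (|k| + Real.exp 1)⁻¹ := by
      have h2 : (|k| ^ 2)⁻¹ ≤ |k|⁻¹ := by
        gcongr
        nlinarith
      have h3 : |k|⁻¹ ≤ 4 * (|k| + Real.exp 1)⁻¹ := by
        rw [inv_eq_one_div, ← div_eq_mul_inv, div_le_div_iff₀ hk0 (by positivity)]
        linarith [Real.exp_one_lt_d9]
      linarith
    calc _ ≤ (A / Real.log (|k| + Real.exp 1)) * (B / Real.log (|k| + Real.exp 1)) *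
          (8 * (|k| + Real.exp 1)⁻¹) := by gcongr
      _ = 8 * (A * B) * logMajorant |k| := by
        unfold logMajorant
        field_simp
      _ ≤ _ := by
        gcongr
        have : 0 ≤ 2 * (P * Q) / logMajorant 1 := by positivity
        linarith

theorem bose_nonneg {u : ℝ} (hu : 0 < u) : 0 ≤ bose u := by
  unfold bose
  have : 1 < Real.exp u := by simpa using hu
  exact inv_nonneg.2 (by linarith)

theorem bose_le_inv {u : ℝ} (hu : 0 < u) : bose u ≤ u⁻¹ := by
  unfold bose
  gcongr
  linarith [Real.add_one_le_exp u]

theorem continuousOn_bose {β : ℝ} (hβ : 0 < β) :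
    ContinuousOn (fun k => bose (β * k)) (Set.Ioi 0) := by
  unfold bose
  refine ContinuousOn.inv₀ (by fun_prop) fun k hk => ?_
  have : 1 < Real.exp (β * k) := by simpa using mul_pos hβ hk
  exact (by linarith : (0 : ℝ) < _).ne'

/-- The zero-temperature part of the spectral density. -/
def vacuumDensity (m : Model) (f h : 𝓢(ℝ, ℂ)) (k : ℝ) : ℂ :=
  ((2 * k)⁻¹ : ℝ) * (amplitude m f k * star (amplitude m h k))

/-- The temperature-dependent part of the spectral density. -/
def excitedDensity (m : Model) (β : ℝ) (f h : 𝓢(ℝ, ℂ)) (k : ℝ) : ℂ :=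
  ((2 * k)⁻¹ * bose (β * k) : ℝ) *
    (amplitude m f k * star (amplitude m h k) + amplitude m f (-k) * star (amplitude m h (-k)))

theorem spectralDensity_eq (m : Model) (β : ℝ) (f h : 𝓢(ℝ, ℂ)) (k : ℝ) :
    spectralDensity m β f h k = vacuumDensity m f h k + excitedDensity m β f h k := by
  rw [spectralDensity, vacuumDensity, excitedDensity]
  push_cast
  ring

theorem continuousOn_vacuumDensity (m : Model) (f h : 𝓢(ℝ, ℂ)) :
    ContinuousOn (vacuumDensity m f h) (Set.Ioi 0) := by
  have h1 := continuous_amplitude m f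
  have h2 := continuous_amplitude m h
  unfold vacuumDensity
  refine ContinuousOn.mul ?_ (h1.mul (continuous_star.comp h2)).continuousOn
  refine Complex.continuous_ofReal.comp_continuousOn (ContinuousOn.inv₀ (by fun_prop) fun k hk => ?_)
  have : 0 < k := hk
  positivity

theorem continuousOn_excitedDensity (m : Model) {β : ℝ} (hβ : 0 < β) (f h : 𝓢(ℝ, ℂ)) :
    ContinuousOn (excitedDensity m β f h) (Set.Ioi 0) := by
  have h1 := continuous_amplitude m f
  have h2 := continuous_amplitude m h
  unfold excitedDensity
  refine ContinuousOn.mul ?_ (((h1.mul (continuous_star.comp h2)).add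
    ((h1.comp continuous_neg).mul (continuous_star.comp (h2.comp continuous_neg)))).continuousOn)
  refine Complex.continuous_ofReal.comp_continuousOn (ContinuousOn.mul
    (ContinuousOn.inv₀ (by fun_prop) fun k hk => ?_) (continuousOn_bose hβ))
  have : 0 < k := hk
  positivity

theorem exists_norm_vacuumDensity_le {m : Model} {f h : 𝓢(ℝ, ℂ)} (hf : Adapted m f)
    (hh : Adapted m h) :
    ∃ C, 0 ≤ C ∧ ∀ k > 0, ‖vacuumDensity m f h k‖ ≤ C * logMajorant k := by
  obtain ⟨C, hC, hC'⟩ := exists_norm_amplitude_mul_le hf hh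
  refine ⟨C, hC, fun k hk => ?_⟩
  have h1 := hC' k hk.ne'
  rw [abs_of_pos hk] at h1
  refine le_trans ?_ h1
  rw [vacuumDensity, norm_mul, Complex.norm_real, Real.norm_of_nonneg (by positivity), mul_comm]
  gcongr
  rw [mul_inv]
  have : 0 < k⁻¹ := by positivity
  have : 0 < (k ^ 2)⁻¹ := by positivity
  linarith

theorem exists_norm_excitedDensity_le {m : Model} {β : ℝ} (hβ : 0 < β) {f h : 𝓢(ℝ, ℂ)}
    (hf : Adapted m f) (hh : Adapted m h) :
    ∃ C, 0 ≤ C ∧ ∀ k > 0, ‖excitedDensity m β f h k‖ ≤ C * logMajorant k := by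
  obtain ⟨C, hC, hC'⟩ := exists_norm_amplitude_mul_le hf hh
  refine ⟨β⁻¹ * C, by positivity, fun k hk => ?_⟩
  have h1 := hC' k hk.ne'
  have h2 := hC' (-k) (neg_ne_zero.2 hk.ne')
  rw [abs_neg] at h2
  rw [abs_of_pos hk] at h1 h2
  have hb := bose_nonneg (mul_pos hβ hk)
  have hb' : (2 * k)⁻¹ * bose (β * k) ≤ β⁻¹ / 2 * (k⁻¹ + (k ^ 2)⁻¹) := by
    calc (2 * k)⁻¹ * bose (β * k) ≤ (2 * k)⁻¹ * (β * k)⁻¹ := by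
          gcongr; exact bose_le_inv (mul_pos hβ hk)
      _ = β⁻¹ / 2 * (k ^ 2)⁻¹ := by field_simp
      _ ≤ _ := by
        gcongr
        have : 0 < k⁻¹ := by positivity
        linarith
  rw [excitedDensity, norm_mul, Complex.norm_real, Real.norm_of_nonneg (by positivity)]
  calc _ ≤ (β⁻¹ / 2 * (k⁻¹ + (k ^ 2)⁻¹)) * (‖amplitude m f k * star (amplitude m h k)‖ +
        ‖amplitude m f (-k) * star (amplitude m h (-k))‖) := by
        gcongr
        exact norm_add_le _ _
    _ = β⁻¹ / 2 * (‖amplitude m f k * star (amplitude m h k)‖ * (k⁻¹ + (k ^ 2)⁻¹) +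
        ‖amplitude m f (-k) * star (amplitude m h (-k))‖ * (k⁻¹ + (k ^ 2)⁻¹)) := by ring
    _ ≤ β⁻¹ / 2 * (C * logMajorant k + C * logMajorant k) := by gcongr
    _ = _ := by ring

theorem integrableOn_of_norm_le_logMajorant {g : ℝ → ℂ} (hg : ContinuousOn g (Set.Ioi 0)) {C : ℝ}
    (hC : ∀ k > 0, ‖g k‖ ≤ C * logMajorant k) : IntegrableOn g (Set.Ioi 0) :=
  (integrableOn_logMajorant.const_mul C).mono' (hg.aestronglyMeasurable measurableSet_Ioi)
    ((ae_restrict_iff' measurableSet_Ioi).2 (.of_forall hC))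

/-- The thermal two-point function is the sum of the momentum integrals of its vacuum and its
excited parts. -/
theorem thermalInTwoPt_of_adapted (t : FieldType) {m : Model} {β : ℝ} (hβ : 0 < β) {f h : 𝓢(ℝ, ℂ)}
    (hf : Adapted m f) (hh : Adapted m h) :
    thermalInTwoPt t m β f h ((∫ k in Set.Ioi 0, vacuumDensity m f h k) +
      ∫ k in Set.Ioi 0, excitedDensity m β f h k) := by
  obtain ⟨A, hA, hA'⟩ := exists_norm_vacuumDensity_le hf hh
  obtain ⟨B, hB, hB'⟩ := exists_norm_excitedDensity_le hβ hf hh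
  have hc1 := continuousOn_vacuumDensity m f h
  have hc2 := continuousOn_excitedDensity m hβ f h
  have hc : ContinuousOn (spectralDensity m β f h) (Set.Ioi 0) := by
    simp_rw [funext (spectralDensity_eq m β f h)]
    exact hc1.add hc2
  have hb (k : ℝ) (hk : k > 0) :
      ‖spectralDensity m β f h k‖ ≤ (A + B) * logMajorant k := by
    rw [spectralDensity_eq, add_mul]
    exact (norm_add_le _ _).trans (add_le_add (hA' k hk) (hB' k hk))
  have hanti : AntitoneOn (fun k => (A + B) * logMajorant k) (Set.Ioi 0) := fun a ha b hb hab =>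
    mul_le_mul_of_nonneg_left (antitoneOn_logMajorant ha hb hab) (add_nonneg hA hB)
  have hint := integrableOn_logMajorant.const_mul (A + B)
  refine ⟨fun δ => ∫ k in Set.Ioi 0, spectralDensity m β f h (⌈k / δ⌉₊ * δ), fun δ hδ => ?_, ?_⟩
  · simp_rw [boxTwoPt_eq t m hβ hδ]
    exact tendsto_sum_step hb hanti hint hδ
  · have := tendsto_integral_step hc hb hanti hint
    rwa [integral_congr_ae (.of_forall (spectralDensity_eq m β f h)),
      integral_add (integrableOn_of_norm_le_logMajorant hc1 hA')
        (integrableOn_of_norm_le_logMajorant hc2 hB')] at this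

/-! ### Frullani integrals -/

section Frullani

theorem norm_exp_neg_mul (z : ℂ) (k : ℝ) : ‖Complex.exp (-(z * k))‖ = Real.exp (-(z.re * k)) := by
  rw [Complex.norm_exp]
  simp

/-- Mean value inequality in `z` on the half-plane `Re ≥ c`, which contains both `z` and 1. The
derivative carries a factor `k`, cancelling the denominator. -/
theorem norm_exp_sub_exp_div_le {z : ℂ} {c k : ℝ} (hc : c ≤ z.re) (hc1 : c ≤ 1) (hk : 0 < k) :
    ‖(Complex.exp (-(z * k)) - Complex.exp (-(k : ℂ))) / k‖ ≤ ‖z - 1‖ * Real.exp (-(c * k)) := by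
  have hconv : Convex ℝ {w : ℂ | c ≤ w.re} := convex_halfSpace_re_ge c
  have h := hconv.norm_image_sub_le_of_norm_hasDerivWithin_le
    (f := fun w : ℂ => Complex.exp (-(w * k))) (f' := fun w => Complex.exp (-(w * k)) * -(1 * (k : ℂ)))
    (C := k * Real.exp (-(c * k))) (x := 1) (y := z)
    (fun w _ => (((hasDerivAt_id w).mul_const (k : ℂ)).neg.cexp).hasDerivWithinAt)
    (fun w hw => by
      rw [norm_mul, norm_exp_neg_mul, norm_neg, one_mul, Complex.norm_real,
        Real.norm_of_nonneg hk.le, mul_comm]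
      gcongr
      exact hw) (by simpa using hc1) hc
  rw [one_mul] at h
  rw [norm_div, Complex.norm_real, Real.norm_of_nonneg hk.le, div_le_iff₀ hk]
  linarith

theorem integrableOn_exp_neg_mul {c : ℝ} (hc : 0 < c) :
    IntegrableOn (fun k : ℝ => Real.exp (-(c * k))) (Set.Ioi 0) := by
  simpa [neg_mul] using integrableOn_exp_mul_Ioi (neg_lt_zero.2 hc) 0

theorem measurable_exp_sub_exp_div (z : ℂ) :
    Measurable fun k : ℝ => (Complex.exp (-(z * k)) - Complex.exp (-(k : ℂ))) / k := by
  fun_prop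

theorem integrableOn_exp_sub_exp_div {z : ℂ} (hz : 0 < z.re) :
    IntegrableOn (fun k : ℝ => (Complex.exp (-(z * k)) - Complex.exp (-(k : ℂ))) / k)
      (Set.Ioi 0) :=
  ((integrableOn_exp_neg_mul (lt_min hz one_pos)).const_mul _).mono'
    (measurable_exp_sub_exp_div z).aestronglyMeasurable
    ((ae_restrict_iff' measurableSet_Ioi).2 (.of_forall fun _ hk =>
      norm_exp_sub_exp_div_le (min_le_left _ _) (min_le_right _ _) hk))

theorem hasDerivAt_integral_exp_sub_exp_div {z : ℂ} (hz : 0 < z.re) :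
    HasDerivAt (fun z : ℂ => ∫ k : ℝ in Set.Ioi 0,
      (Complex.exp (-(z * k)) - Complex.exp (-(k : ℂ))) / k) (-z⁻¹) z := by
  have hs : {w : ℂ | z.re / 2 < w.re} ∈ 𝓝 z :=
    (isOpen_lt continuous_const Complex.continuous_re).mem_nhds (by simp; linarith)
  have h := (hasDerivAt_integral_of_dominated_loc_of_deriv_le (μ := volume.restrict (Set.Ioi 0))
    (F := fun (z : ℂ) (k : ℝ) => (Complex.exp (-(z * k)) - Complex.exp (-(k : ℂ))) / k)
    (F' := fun (z : ℂ) (k : ℝ) => -Complex.exp (-(z * k)))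
    (bound := fun k => Real.exp (-(z.re / 2 * k))) hs
    (.of_forall fun w => (measurable_exp_sub_exp_div w).aestronglyMeasurable)
    (integrableOn_exp_sub_exp_div hz) (by fun_prop)
    ((ae_restrict_iff' measurableSet_Ioi).2 (.of_forall fun k hk w hw => ?_))
    (integrableOn_exp_neg_mul (by linarith))
    ((ae_restrict_iff' measurableSet_Ioi).2 (.of_forall fun k hk w hw => ?_))).2
  · convert! h using 1
    have := integral_exp_mul_complex_Ioi (a := -z) (by simpa using hz) 0
    simp only [Complex.ofReal_zero, mul_zero, Complex.exp_zero, neg_mul] at this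
    rw [integral_neg, this, neg_div_neg_eq, one_div]
  · have hk : 0 < k := hk
    rw [norm_neg, norm_exp_neg_mul]
    gcongr
    exact le_of_lt hw
  · have hk : (k : ℂ) ≠ 0 := by exact_mod_cast (ne_of_gt hk)
    refine ((((hasDerivAt_id w).mul_const (k : ℂ)).neg.cexp.sub_const _).div_const _).congr_deriv ?_
    simp only [Pi.neg_apply, id]
    field_simp

/-- Frullani's integral for exponentials with complex rates. -/
theorem integral_exp_sub_exp_div {z : ℂ} (hz : 0 < z.re) :
    ∫ k : ℝ in Set.Ioi 0, (Complex.exp (-(z * k)) - Complex.exp (-(k : ℂ))) / k =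
      -Complex.log z := by
  set J : ℂ → ℂ := fun z => ∫ k : ℝ in Set.Ioi 0,
    (Complex.exp (-(z * k)) - Complex.exp (-(k : ℂ))) / k with hJ
  set U : Set ℂ := {w | 0 < w.re} with hU
  -- `J + log` has zero derivative on the convex right half-plane and vanishes at 1.
  have hd (w : ℂ) (hw : w ∈ U) : HasDerivAt (fun w => J w + Complex.log w) 0 w := by
    refine ((hasDerivAt_integral_exp_sub_exp_div hw).add
      (Complex.hasDerivAt_log (Or.inl hw))).congr_deriv ?_
    simp
  have hconst := (convex_halfSpace_re_gt 0).norm_image_sub_le_of_norm_hasDerivWithin_le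
    (f := fun w => J w + Complex.log w) (f' := fun _ => 0) (C := 0) (x := 1) (y := z)
    (fun w hw => (hd w hw).hasDerivWithinAt) (fun w _ => norm_zero.le)
    (show (0 : ℝ) < (1 : ℂ).re by simp) hz
  have h1 : J 1 = 0 := by simp [hJ]
  rw [zero_mul, norm_le_zero_iff, h1, Complex.log_one, add_zero, sub_zero] at hconst
  exact eq_neg_of_add_eq_zero_left hconst

/-- The counterterms `exp (-k)` cancel, so the damped cosine integral is minus the real part of a
difference of Frullani integrals, that is `log |a - i s| - log a`. -/
theorem exp_sub_exp_div_re (a s k : ℝ) :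
    ((Complex.exp (-((a - Complex.I * s) * k)) - Complex.exp (-(k : ℂ))) / k -
      (Complex.exp (-((a : ℂ) * k)) - Complex.exp (-(k : ℂ))) / k).re =
      -((1 - Real.cos (k * s)) / k * Real.exp (-(a * k))) := by
  have h1 : Complex.exp (-((a - Complex.I * s) * k)) =
      (Real.exp (-(a * k)) : ℂ) * (Real.cos (k * s) + Real.sin (k * s) * Complex.I) := by
    rw [Complex.ofReal_exp, Complex.ofReal_cos, Complex.ofReal_sin, ← Complex.exp_mul_I,
      ← Complex.exp_add]
    congr 1
    push_cast
    ring
  have h2 : Complex.exp (-((a : ℂ) * k)) = (Real.exp (-(a * k)) : ℂ) := by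
    push_cast; rfl
  rw [← sub_div, sub_sub_sub_cancel_right, h1, h2, Complex.div_ofReal_re]
  simp only [Complex.sub_re, Complex.mul_re, Complex.ofReal_re, Complex.ofReal_im, Complex.add_re,
    Complex.add_im, Complex.mul_im, Complex.I_re, Complex.I_im]
  ring

theorem integrableOn_one_sub_cos_div_mul_exp {a : ℝ} (ha : 0 < a) (s : ℝ) :
    IntegrableOn (fun k => (1 - Real.cos (k * s)) / k * Real.exp (-(a * k))) (Set.Ioi 0) := by
  have h := ((integrableOn_exp_sub_exp_div (z := a - Complex.I * s) (by simpa using ha)).sub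
    (integrableOn_exp_sub_exp_div (z := a) (by simpa using ha))).re.neg
  refine h.congr (.of_forall fun k => ?_)
  simp only [Pi.neg_apply, Pi.sub_apply, RCLike.re_to_complex]
  rw [exp_sub_exp_div_re, neg_neg]

theorem integral_one_sub_cos_div_mul_exp {a : ℝ} (ha : 0 < a) (s : ℝ) :
    ∫ k in Set.Ioi 0, (1 - Real.cos (k * s)) / k * Real.exp (-(a * k)) =
      Real.log (1 + s ^ 2 / a ^ 2) / 2 := by
  have h1 := integrableOn_exp_sub_exp_div (z := a - Complex.I * s) (by simpa using ha)
  have h2 := integrableOn_exp_sub_exp_div (z := a) (by simpa using ha)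
  have h3 : ∫ k in Set.Ioi 0, (1 - Real.cos (k * s)) / k * Real.exp (-(a * k)) =
      -(∫ k : ℝ in Set.Ioi 0, ((Complex.exp (-((a - Complex.I * s) * k)) -
        Complex.exp (-(k : ℂ))) / k -
          (Complex.exp (-((a : ℂ) * k)) - Complex.exp (-(k : ℂ))) / k)).re := by
    have h4 := integral_re (h1.sub h2)
    simp only [RCLike.re_to_complex, Pi.sub_apply] at h4
    rw [← h4, ← integral_neg]
    refine integral_congr_ae (.of_forall fun k => ?_)
    simp only
    rw [exp_sub_exp_div_re, neg_neg]
  rw [h3, integral_sub h1 h2, integral_exp_sub_exp_div (by simpa using ha),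
    integral_exp_sub_exp_div (by simpa using ha), Complex.sub_re, Complex.neg_re, Complex.neg_re,
    Complex.log_re, Complex.log_re, Complex.norm_real, Real.norm_of_nonneg ha.le]
  have hn : ‖(a - Complex.I * s : ℂ)‖ = Real.sqrt (a ^ 2 + s ^ 2) := by
    rw [Complex.norm_eq_sqrt_sq_add_sq]
    simp
  have h5 : 1 + s ^ 2 / a ^ 2 = (a ^ 2 + s ^ 2) / a ^ 2 := by field_simp
  rw [hn, Real.log_sqrt (by positivity), h5, Real.log_div (by positivity) (by positivity),
    Real.log_pow]
  push_cast
  ring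

end Frullani

/-! ### The thermal shift -/

/-- The logarithm of the ratio between the thermal and the vacuum correlation, as a function of
the separation. -/
def thermalShift (β s : ℝ) : ℝ :=
  ∫ k in Set.Ioi 0, 2 / k * (1 - Real.cos (k * s)) * bose (β * k)

/-- Equivalent to `u / 2 ≤ sinh (u / 2)`. -/
theorem mul_bose_le {u : ℝ} (hu : 0 < u) : u * bose u ≤ Real.exp (-(u / 2)) := by
  have h1 : 1 < Real.exp u := by simpa using hu
  rw [bose, ← div_eq_mul_inv, div_le_iff₀ (by linarith)]
  have h2 : Real.exp (-(u / 2)) * (Real.exp u - 1) = Real.exp (u / 2) - Real.exp (-(u / 2)) := by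
    rw [mul_sub, ← Real.exp_add, mul_one]
    congr 2
    ring
  have h3 := Real.self_le_sinh_iff.2 (half_pos hu).le
  rw [h2]
  rw [Real.sinh_eq] at h3
  linarith

theorem shift_integrand_nonneg {β k : ℝ} (hβ : 0 < β) (hk : 0 < k) (s : ℝ) :
    0 ≤ 2 / k * (1 - Real.cos (k * s)) * bose (β * k) :=
  mul_nonneg (mul_nonneg (by positivity) (by linarith [Real.cos_le_one (k * s)]))
    (bose_nonneg (mul_pos hβ hk))

theorem shift_integrand_le {β k : ℝ} (hβ : 0 < β) (hk : 0 < k) (s : ℝ) :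
    2 / k * (1 - Real.cos (k * s)) * bose (β * k) ≤ s ^ 2 * (β⁻¹ * Real.exp (-(β / 2 * k))) := by
  have h1 := mul_bose_le (mul_pos hβ hk)
  have h2 : 1 - Real.cos (k * s) ≤ (k * s) ^ 2 / 2 := by linarith [Real.one_sub_sq_div_two_le_cos (x := k * s)]
  have h3 := bose_nonneg (mul_pos hβ hk)
  calc 2 / k * (1 - Real.cos (k * s)) * bose (β * k)
      ≤ 2 / k * ((k * s) ^ 2 / 2) * bose (β * k) := by gcongr
    _ = s ^ 2 * (β⁻¹ * (β * k * bose (β * k))) := by field_simp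
    _ ≤ s ^ 2 * (β⁻¹ * Real.exp (-(β * k / 2))) := by gcongr
    _ = _ := by rw [mul_div_right_comm]

theorem measurable_shift_integrand (β s : ℝ) :
    Measurable fun k => 2 / k * (1 - Real.cos (k * s)) * bose (β * k) := by
  unfold bose
  fun_prop

theorem integrableOn_shift_integrand {β : ℝ} (hβ : 0 < β) (s : ℝ) :
    IntegrableOn (fun k => 2 / k * (1 - Real.cos (k * s)) * bose (β * k)) (Set.Ioi 0) := by
  refine (((integrableOn_exp_neg_mul (half_pos hβ)).const_mul β⁻¹).const_mul (s ^ 2)).mono'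
    (measurable_shift_integrand β s).aestronglyMeasurable
    ((ae_restrict_iff' measurableSet_Ioi).2 (.of_forall fun k hk => ?_))
  rw [Real.norm_of_nonneg (shift_integrand_nonneg hβ hk s)]
  exact shift_integrand_le hβ hk s

theorem thermalShift_nonneg {β : ℝ} (hβ : 0 < β) (s : ℝ) : 0 ≤ thermalShift β s :=
  setIntegral_nonneg measurableSet_Ioi fun _ hk => shift_integrand_nonneg hβ hk s

/-- From `1 - cos θ ≤ θ² / 2`. This quadratic bound is why the incoming temperature is forgotten
near the horizon. -/
theorem thermalShift_le {β : ℝ} (hβ : 0 < β) (s : ℝ) :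
    thermalShift β s ≤ 2 / β ^ 2 * s ^ 2 := by
  have h := setIntegral_mono_on (integrableOn_shift_integrand hβ s)
    (((integrableOn_exp_neg_mul (half_pos hβ)).const_mul β⁻¹).const_mul (s ^ 2)) measurableSet_Ioi
    fun k hk => shift_integrand_le hβ hk s
  refine h.trans_eq ?_
  have h2 := integral_exp_mul_Ioi (a := -(β / 2)) (by linarith) 0
  simp only [neg_mul, mul_zero, Real.exp_zero] at h2
  rw [integral_const_mul, integral_const_mul, h2]
  field_simp

theorem sum_exp_le_bose {u : ℝ} (hu : 0 < u) (N : ℕ) :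
    ∑ n ∈ Finset.range N, Real.exp (-((n + 1 : ℝ) * u)) ≤ bose u ∧
      HasSum (fun n : ℕ => Real.exp (-((n + 1 : ℝ) * u))) (bose u) := by
  have h1 : Real.exp (-u) < 1 := by simpa using hu
  have hs : HasSum (fun n : ℕ => Real.exp (-((n + 1 : ℝ) * u))) (bose u) := by
    convert! (hasSum_geometric_of_lt_one (Real.exp_pos _).le h1).mul_left (Real.exp (-u)) using 1
    · funext n
      rw [← Real.exp_nat_mul, ← Real.exp_add]
      congr 1
      ring
    · have : 1 < Real.exp u := by simpa using hu
      have h2 : Real.exp u - 1 ≠ 0 := by linarith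
      rw [bose, Real.exp_neg]
      field_simp
  exact ⟨sum_le_hasSum _ (fun n _ => (Real.exp_pos _).le) hs, hs⟩

/-- Expand `bose` in a geometric series: the `n`-th term is a damped cosine integral with `a = (n +
1) β`. All terms are nonnegative, so the full integrand dominates the partial sums. -/
theorem tendsto_sum_log_thermalShift {β : ℝ} (hβ : 0 < β) (s : ℝ) :
    Tendsto (fun N : ℕ => ∑ n ∈ Finset.range N, Real.log (1 + s ^ 2 / ((n + 1) * β) ^ 2)) atTop
      (𝓝 (thermalShift β s)) := by
  have hterm (N : ℕ) : ∑ n ∈ Finset.range N, Real.log (1 + s ^ 2 / ((n + 1) * β) ^ 2) =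
      ∫ k in Set.Ioi 0, 2 / k * (1 - Real.cos (k * s)) *
        ∑ n ∈ Finset.range N, Real.exp (-((n + 1 : ℝ) * (β * k))) := by
    simp_rw [Finset.mul_sum]
    have hr (n : ℕ) (k : ℝ) : 2 / k * (1 - Real.cos (k * s)) *
        Real.exp (-((n + 1 : ℝ) * (β * k))) =
          2 * ((1 - Real.cos (k * s)) / k * Real.exp (-(((n + 1 : ℝ) * β) * k))) := by
      rw [mul_assoc ((n : ℝ) + 1)]
      ring
    simp_rw [hr]
    rw [integral_finsetSum _ fun n _ =>
      (integrableOn_one_sub_cos_div_mul_exp (by positivity) s).const_mul 2]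
    refine Finset.sum_congr rfl fun n _ => ?_
    rw [integral_const_mul, integral_one_sub_cos_div_mul_exp (by positivity)]
    ring
  simp_rw [hterm]
  refine tendsto_integral_of_dominated_convergence _ (fun N => ?_)
    (integrableOn_shift_integrand hβ s) (fun N => ?_) ?_
  · exact Measurable.aestronglyMeasurable (by fun_prop)
  · refine (ae_restrict_iff' measurableSet_Ioi).2 (.of_forall fun k hk => ?_)
    have hk : 0 < k := hk
    have hc : 0 ≤ 1 - Real.cos (k * s) := by linarith [Real.cos_le_one (k * s)]
    rw [Real.norm_of_nonneg (by positivity)]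
    gcongr
    exact (sum_exp_le_bose (mul_pos hβ hk) N).1
  · refine (ae_restrict_iff' measurableSet_Ioi).2 (.of_forall fun k hk => ?_)
    exact ((sum_exp_le_bose (mul_pos hβ hk) 0).2.tendsto_sum_nat).const_mul _

/-- Imaginary part of Euler's sine product at `i t`. -/
theorem tendsto_prod_sinh (t : ℝ) :
    Tendsto (fun N : ℕ => Real.pi * t * ∏ n ∈ Finset.range N, (1 + t ^ 2 / ((n : ℝ) + 1) ^ 2)) atTop
      (𝓝 (Real.sinh (Real.pi * t))) := by
  have h := (Complex.continuous_im.tendsto _).comp (Complex.tendsto_euler_sin_prod (t * Complex.I))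
  convert! h using 1
  · funext N
    have : (∏ j ∈ Finset.range N, (1 - (t * Complex.I) ^ 2 / ((j : ℂ) + 1) ^ 2)) =
        ((∏ n ∈ Finset.range N, (1 + t ^ 2 / ((n : ℝ) + 1) ^ 2) : ℝ) : ℂ) := by
      push_cast
      refine Finset.prod_congr rfl fun n _ => ?_
      rw [mul_pow, Complex.I_sq]
      ring
    rw [Function.comp_apply, this, show (Real.pi : ℂ) * (t * Complex.I) *
      ((∏ n ∈ Finset.range N, (1 + t ^ 2 / ((n : ℝ) + 1) ^ 2) : ℝ) : ℂ) =
      ((Real.pi * t * ∏ n ∈ Finset.range N, (1 + t ^ 2 / ((n : ℝ) + 1) ^ 2) : ℝ) : ℂ) * Complex.I by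
        push_cast; ring]
    simp only [Complex.mul_im, Complex.I_re, Complex.I_im, Complex.ofReal_re, Complex.ofReal_im]
    ring
  · rw [← mul_assoc, Complex.sin_mul_I, ← Complex.ofReal_mul, ← Complex.ofReal_sinh]
    simp only [Complex.mul_im, Complex.I_re, Complex.I_im, Complex.ofReal_re, Complex.ofReal_im]
    simp

/-- The thermal shift in closed form. -/
theorem mul_exp_thermalShift {β : ℝ} (hβ : 0 < β) (s : ℝ) :
    s * Real.exp (thermalShift β s) = β / Real.pi * Real.sinh (Real.pi / β * s) := by
  have h1 := (Real.continuous_exp.tendsto _).comp (tendsto_sum_log_thermalShift hβ s)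
  have h2 := (tendsto_prod_sinh (s / β)).const_mul (β / Real.pi)
  have h3 := h1.const_mul s
  rw [show Real.pi * (s / β) = Real.pi / β * s by ring] at h2
  refine tendsto_nhds_unique h3 (h2.congr fun N => ?_)
  rw [Function.comp_apply, Real.exp_sum]
  have : ∏ n ∈ Finset.range N, Real.exp (Real.log (1 + s ^ 2 / (((n : ℝ) + 1) * β) ^ 2)) =
      ∏ n ∈ Finset.range N, (1 + (s / β) ^ 2 / ((n : ℝ) + 1) ^ 2) := by
    refine Finset.prod_congr rfl fun n _ => ?_
    rw [Real.exp_log (by positivity)]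
    congr 1
    rw [mul_pow, div_pow, div_div, mul_comm]
  rw [this]
  have := Real.pi_ne_zero
  field_simp

/-! ### Double integrals against product test functions -/

/-- The product test function `f(y) conj h(y')`. -/
def tensor (f h : 𝓢(ℝ, ℂ)) (p : ℝ × ℝ) : ℂ := f p.1 * star (h p.2)

theorem continuous_tensor (f h : 𝓢(ℝ, ℂ)) : Continuous (tensor f h) :=
  (f.continuous.comp continuous_fst).mul (continuous_star.comp (h.continuous.comp continuous_snd))

theorem integrable_tensor (f h : 𝓢(ℝ, ℂ)) : Integrable (tensor f h) :=
  f.integrable.mul_prod (g := fun y => star (h y))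
    ((integrable_norm_iff (continuous_star.comp h.continuous).aestronglyMeasurable).1
      (by simpa using h.integrable.norm))

theorem integral_tensor_mul {f h : 𝓢(ℝ, ℂ)} (a b : ℝ → ℂ) :
    ∫ p, tensor f h p * (a p.1 * b p.2) = (∫ y, f y * a y) * ∫ y, star (h y) * b y := by
  rw [← integral_prod_mul]
  refine integral_congr_ae (.of_forall fun p => ?_)
  simp only [tensor]
  ring

/-- The `y'` integral factors out as the zero mean of `h`; with its mirror image this lets
one-variable terms be dropped from a kernel. -/
theorem integral_tensor_fst {f h : 𝓢(ℝ, ℂ)} (hh : ∫ y, h y = 0) (a : ℝ → ℂ) :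
    ∫ p, tensor f h p * a p.1 = 0 := by
  have := integral_tensor_mul (f := f) (h := h) a fun _ => 1
  have hs : ∫ y, star (h y) = 0 := by
    have h1 := integral_conj (f := (h : ℝ → ℂ)) (μ := volume)
    rw [hh, map_zero] at h1
    exact h1
  simp_rw [mul_one, hs, mul_zero] at this
  exact this

theorem integral_tensor_snd {f h : 𝓢(ℝ, ℂ)} (hf : ∫ y, f y = 0) (b : ℝ → ℂ) :
    ∫ p, tensor f h p * b p.2 = 0 := by
  have := integral_tensor_mul (f := f) (h := h) (fun _ => 1) b
  simpa [hf] using this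

theorem integrable_weight_tensor (f h : 𝓢(ℝ, ℂ)) (n : ℕ) :
    Integrable fun p : ℝ × ℝ => ‖tensor f h p‖ * ((1 + |p.1|) ^ n * (1 + |p.2|) ^ n) := by
  refine ((integrable_weight f n).mul_prod (integrable_weight h n)).congr (.of_forall fun p => ?_)
  simp only [tensor, norm_mul, norm_star]
  ring

theorem ae_ne : ∀ᵐ p : ℝ × ℝ, p.1 ≠ p.2 := by
  rw [Measure.volume_eq_prod]
  refine (Measure.ae_prod_iff_ae_ae ?_).2 (.of_forall fun y => ?_)
  · exact (measurableSet_eq_fun measurable_fst measurable_snd).compl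
  · refine (measure_eq_zero_iff_ae_notMem.1 (measure_singleton (μ := (volume : Measure ℝ)) y)).mono
      fun z hz h => hz h.symm

/-- Near the diagonal `h` is bounded and the logarithm integrable, giving a convolution integrand;
elsewhere `|log t| ≤ |t|` is absorbed by the Schwartz decay. -/
theorem integrable_tensor_mul_log (f h : 𝓢(ℝ, ℂ)) :
    Integrable fun p : ℝ × ℝ => ‖tensor f h p‖ * |Real.log (p.2 - p.1)| := by
  set g : ℝ → ℝ := (Set.Icc (-1) 1).indicator fun t => |Real.log t| with hg
  have hgi : Integrable g := by
    rw [hg, integrable_indicator_iff measurableSet_Icc]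
    have := (intervalIntegral.intervalIntegrable_log' (a := -1) (b := 1)).abs
    rwa [intervalIntegrable_iff_integrableOn_Icc_of_le (by norm_num)] at this
  obtain ⟨M, hM⟩ : ∃ M, ∀ y, ‖h y‖ ≤ M := ⟨_, fun y => h.norm_le_seminorm ℝ y⟩
  have hM0 : 0 ≤ M := (norm_nonneg _).trans (hM 0)
  have hconv := ((f.integrable (μ := volume)).norm.convolution_integrand (ContinuousLinearMap.mul ℝ ℝ) hgi).swap
  have hb := (hconv.const_mul M).add (integrable_weight_tensor f h 1)
  refine hb.mono' ?_ (.of_forall fun p => ?_)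
  · exact ((continuous_tensor f h).norm.measurable.mul (by fun_prop)).aestronglyMeasurable
  · simp only [Function.comp_apply, Prod.swap, ContinuousLinearMap.mul_apply', Pi.add_apply]
    rw [Real.norm_of_nonneg (by positivity)]
    by_cases hp : p.2 - p.1 ∈ Set.Icc (-1 : ℝ) 1
    · have h1 : g (p.2 - p.1) = |Real.log (p.2 - p.1)| := Set.indicator_of_mem hp _
      have h2 : ‖tensor f h p‖ ≤ M * ‖f p.1‖ := by
        rw [tensor, norm_mul, norm_star, mul_comm]
        gcongr
        exact hM _
      have h3 : 0 ≤ ‖tensor f h p‖ * ((1 + |p.1|) ^ 1 * (1 + |p.2|) ^ 1) := by positivity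
      have h4 := mul_le_mul_of_nonneg_right h2 (abs_nonneg (Real.log (p.2 - p.1)))
      rw [h1]
      linarith
    · have h1 : g (p.2 - p.1) = 0 := Set.indicator_of_notMem hp _
      rw [h1, mul_zero, mul_zero, zero_add]
      gcongr
      have h2 : 1 ≤ |p.2 - p.1| := by
        by_contra hlt
        exact hp (abs_le.1 (not_le.1 hlt).le)
      have h3 : |Real.log (p.2 - p.1)| ≤ |p.2 - p.1| := by
        rw [← Real.log_abs, abs_of_nonneg (Real.log_nonneg h2)]
        exact Real.log_le_self (abs_nonneg _)
      have h4 : |p.2 - p.1| ≤ |p.2| + |p.1| := abs_sub _ _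
      nlinarith [abs_nonneg p.1, abs_nonneg p.2, mul_nonneg (abs_nonneg p.1) (abs_nonneg p.2)]

/-- Mean value theorem with `x' = 1 / invSlope`. The exponential loss becomes only linear in `|y|`,
`|z|` under the logarithm. -/
theorem Model.le_abs_x_sub (m : Model) (y z : ℝ) :
    |z - y| * Real.exp (-(|y| + |z|)) / 2 ≤ |m.x z - m.x y| := by
  wlog h : y < z generalizing y z
  · rcases (not_lt.1 h).eq_or_lt with h | h
    · simp [h]
    · have := this z y h
      rwa [abs_sub_comm, add_comm |y|, abs_sub_comm (m.x z)]
  obtain ⟨c, hc, hc'⟩ := exists_hasDerivAt_eq_slope m.x (fun y => (m.invSlope y)⁻¹) h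
    m.continuous_x.continuousOn fun y _ => m.hasDerivAt_x y
  have hzy : 0 < z - y := sub_pos.2 h
  rw [eq_div_iff hzy.ne'] at hc'
  rw [← hc', abs_of_pos hzy, abs_of_pos (mul_pos (inv_pos.2 (m.invSlope_pos c)) hzy),
    mul_comm _ (z - y), mul_div_assoc]
  gcongr
  have h1 : m.invSlope c ≤ 2 * Real.exp (|y| + |z|) := by
    have h2 : c ≤ |y| + |z| := by linarith [hc.2, le_abs_self z, abs_nonneg y]
    have h3 : 1 ≤ Real.exp (|y| + |z|) := Real.one_le_exp (by positivity)
    linarith [m.invSlope_le c, Real.exp_le_exp.2 h2]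
  rw [Real.exp_neg, div_eq_mul_inv, ← mul_inv, mul_comm _ (2 : ℝ)]
  exact inv_anti₀ (m.invSlope_pos c) h1

theorem Model.abs_log_x_sub_le (m : Model) {y z : ℝ} (h : y ≠ z) :
    |Real.log (m.x z - m.x y)| ≤
      |Real.log (z - y)| + (1 + |y|) * (1 + |z|) + (1 + |m.x y|) * (1 + |m.x z|) := by
  have h0 : 0 < |z - y| := abs_pos.2 (sub_ne_zero.2 h.symm)
  have h1 := m.le_abs_x_sub y z
  have h2 : 0 < |m.x z - m.x y| := lt_of_lt_of_le (by positivity) h1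
  have h3 : Real.log |z - y| - (|y| + |z|) - Real.log 2 ≤ Real.log |m.x z - m.x y| := by
    rw [← Real.log_exp (|y| + |z|), ← Real.log_div h0.ne' (by positivity),
      ← Real.log_div (by positivity) (by positivity)]
    refine Real.log_le_log (by positivity) (le_trans (le_of_eq ?_) h1)
    rw [Real.exp_neg]
    rfl
  have h4 : Real.log |m.x z - m.x y| ≤ |m.x z| + |m.x y| :=
    (Real.log_le_self h2.le).trans (abs_sub _ _)
  have h5 : Real.log 2 ≤ 1 := by linarith [Real.log_two_lt_d9]
  have h6 := neg_abs_le (Real.log (z - y))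
  rw [Real.log_abs] at h3 h4
  have := mul_nonneg (abs_nonneg y) (abs_nonneg z)
  have := mul_nonneg (abs_nonneg (m.x y)) (abs_nonneg (m.x z))
  rw [Real.log_abs] at h3
  rw [abs_le]
  have := abs_nonneg (m.x y)
  have := abs_nonneg (m.x z)
  have := abs_nonneg y
  have := abs_nonneg z
  have := abs_nonneg (Real.log (z - y))
  constructor <;> nlinarith

theorem Adapted.exists_one_add_le {m : Model} {f : 𝓢(ℝ, ℂ)} (hf : Adapted m f) :
    ∃ C, 0 ≤ C ∧ ∀ y, f y ≠ 0 → 1 + |m.x y| ≤ C * (1 + |y|) := by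
  obtain ⟨-, C, hC⟩ := hf
  refine ⟨1 + |C|, by positivity, fun y hy => ?_⟩
  have := hC y hy
  nlinarith [le_abs_self C, abs_nonneg y, mul_le_mul_of_nonneg_right (le_abs_self C)
    (show 0 ≤ 1 + |y| by positivity)]

theorem Adapted.integrable_x_weight_tensor {m : Model} {f h : 𝓢(ℝ, ℂ)} (hf : Adapted m f)
    (hh : Adapted m h) (n : ℕ) :
    Integrable fun p : ℝ × ℝ =>
      ‖tensor f h p‖ * ((1 + |m.x p.1|) ^ n * (1 + |m.x p.2|) ^ n) := by
  obtain ⟨A, hA, hA'⟩ := hf.exists_one_add_le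
  obtain ⟨B, hB, hB'⟩ := hh.exists_one_add_le
  have hx := m.continuous_x
  have ht := continuous_tensor f h
  refine ((integrable_weight_tensor f h n).const_mul (A ^ n * B ^ n)).mono'
    (Continuous.aestronglyMeasurable (by fun_prop)) (.of_forall fun p => ?_)
  rw [Real.norm_of_nonneg (by positivity)]
  by_cases hp : tensor f h p = 0
  · simp [hp]
  · have h1 : f p.1 ≠ 0 := fun h0 => hp (by simp [tensor, h0])
    have h2 : h p.2 ≠ 0 := fun h0 => hp (by simp [tensor, h0])
    calc ‖tensor f h p‖ * ((1 + |m.x p.1|) ^ n * (1 + |m.x p.2|) ^ n)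
        ≤ ‖tensor f h p‖ * ((A * (1 + |p.1|)) ^ n * (B * (1 + |p.2|)) ^ n) := by
          gcongr
          exacts [hA' _ h1, hB' _ h2]
      _ = _ := by
        rw [mul_pow, mul_pow]
        ring

/-- The separation of two events in the incoming coordinate. -/
def sep (m : Model) (p : ℝ × ℝ) : ℝ := m.x p.2 - m.x p.1

theorem continuous_sep (m : Model) : Continuous (sep m) :=
  (m.continuous_x.comp continuous_snd).sub (m.continuous_x.comp continuous_fst)

theorem sep_ne_zero (m : Model) {p : ℝ × ℝ} (hp : p.1 ≠ p.2) : sep m p ≠ 0 :=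
  sub_ne_zero.2 fun h => hp (m.strictMono_x.injective h).symm

theorem abs_sep_le (m : Model) (p : ℝ × ℝ) : |sep m p| ≤ (1 + |m.x p.1|) * (1 + |m.x p.2|) - 1 := by
  have := abs_sub (m.x p.2) (m.x p.1)
  have := mul_nonneg (abs_nonneg (m.x p.1)) (abs_nonneg (m.x p.2))
  unfold sep
  linarith

theorem Adapted.integrable_tensor_mul_log_sep {m : Model} {f h : 𝓢(ℝ, ℂ)} (hf : Adapted m f)
    (hh : Adapted m h) :
    Integrable fun p : ℝ × ℝ => ‖tensor f h p‖ * |Real.log (sep m p)| := by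
  have hx := continuous_sep m
  have hb := ((integrable_tensor_mul_log f h).add (integrable_weight_tensor f h 1)).add
    (hf.integrable_x_weight_tensor hh 1)
  refine hb.mono' ?_ ?_
  · exact ((continuous_tensor f h).norm.measurable.mul (by fun_prop)).aestronglyMeasurable
  · filter_upwards [ae_ne] with p hp
    rw [Real.norm_of_nonneg (by positivity)]
    simp only [Pi.add_apply, pow_one, ← mul_add]
    gcongr
    exact m.abs_log_x_sub_le hp

theorem amplitude_mul_star_eq (m : Model) (f h : 𝓢(ℝ, ℂ)) (k : ℝ) :
    amplitude m f k * star (amplitude m h k) =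
      ((2 * Real.pi)⁻¹ : ℝ) * ∫ p, tensor f h p * Complex.exp (Complex.I * k * sep m p) := by
  have h1 : star (∫ y, h y * wave m k y) = ∫ y, star (h y) * star (wave m k y) := by
    have := integral_conj (f := fun y => h y * wave m k y) (μ := volume)
    simp only [map_mul] at this
    exact this.symm
  have h2 := integral_tensor_mul (f := f) (h := h) (wave m k) fun y => star (wave m k y)
  have h3 (p : ℝ × ℝ) : wave m k p.1 * star (wave m k p.2) =
      Complex.exp (Complex.I * k * sep m p) := by
    rw [wave, wave, Complex.star_def, ← Complex.exp_conj, ← Complex.exp_add, sep]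
    congr 1
    simp
    ring
  simp_rw [h3] at h2
  have hsq : (((Real.sqrt (2 * Real.pi))⁻¹ : ℝ) : ℂ) * (((Real.sqrt (2 * Real.pi))⁻¹ : ℝ) : ℂ) =
      ((2 * Real.pi)⁻¹ : ℝ) := by
    rw [← Complex.ofReal_mul, ← mul_inv, Real.mul_self_sqrt (by positivity)]
  rw [h2, amplitude_eq, amplitude_eq, star_mul, h1, Complex.star_def, Complex.conj_ofReal, ← hsq]
  ring

theorem integrable_tensor_mul_exp (m : Model) (f h : 𝓢(ℝ, ℂ)) (k : ℝ) :
    Integrable fun p => tensor f h p * Complex.exp (Complex.I * k * sep m p) := by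
  have hs := continuous_sep m
  have ht := continuous_tensor f h
  refine (integrable_tensor f h).mono (Continuous.aestronglyMeasurable (by fun_prop))
    (.of_forall fun p => ?_)
  rw [norm_mul, show Complex.I * k * sep m p = ((k * sep m p : ℝ) : ℂ) * Complex.I by
    push_cast; ring, Complex.norm_exp_ofReal_mul_I, mul_one]

theorem integral_tensor {f h : 𝓢(ℝ, ℂ)} (hf : ∫ y, f y = 0) : ∫ p, tensor f h p = 0 := by
  simpa using integral_tensor_snd (h := h) hf fun _ => 1

theorem ae_fst_pos : ∀ᵐ q : ℝ × ℝ × ℝ ∂((volume.restrict (Set.Ioi 0)).prod volume), 0 < q.1 :=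
  Measure.quasiMeasurePreserving_fst.ae (ae_restrict_mem measurableSet_Ioi)

/-! ### The vacuum part in position space -/

section Vacuum

variable {m : Model} {f h : 𝓢(ℝ, ℂ)}

/-- The damping `exp (-ε k)` will justify Fubini. The counterterm `exp (-k) / k` costs nothing,
since the product test function has zero integral, and it regularizes `k = 0`. -/
theorem exp_mul_vacuumDensity (hf : ∫ y, f y = 0) (ε : ℝ) {k : ℝ} (hk : 0 < k) :
    (Real.exp (-(ε * k)) : ℂ) * vacuumDensity m f h k =
      ((4 * Real.pi)⁻¹ : ℝ) * ∫ p, tensor f h p *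
        ((Complex.exp (-((ε - Complex.I * sep m p) * k)) - Complex.exp (-(k : ℂ))) / k) := by
  have hk' : (k : ℂ) ≠ 0 := by exact_mod_cast hk.ne'
  have h1 (p : ℝ × ℝ) : tensor f h p *
      ((Complex.exp (-((ε - Complex.I * sep m p) * k)) - Complex.exp (-(k : ℂ))) / k) =
      (Real.exp (-(ε * k)) : ℂ) / k * (tensor f h p * Complex.exp (Complex.I * k * sep m p)) -
        Complex.exp (-(k : ℂ)) / k * tensor f h p := by
    have : Complex.exp (-((ε - Complex.I * sep m p) * k)) =
        (Real.exp (-(ε * k)) : ℂ) * Complex.exp (Complex.I * k * sep m p) := by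
      push_cast
      rw [← Complex.exp_add]
      congr 1
      ring
    rw [this]
    ring
  simp_rw [h1]
  rw [integral_sub ((integrable_tensor_mul_exp m f h k).const_mul _)
    ((integrable_tensor f h).const_mul _), integral_const_mul, integral_const_mul,
    integral_tensor hf, mul_zero, sub_zero, vacuumDensity, amplitude_mul_star_eq]
  push_cast
  field_simp
  ring

theorem integrable_vacuum_kernel (hf : Adapted m f) (hh : Adapted m h) {ε : ℝ} (hε : 0 < ε) :
    Integrable (fun q : ℝ × ℝ × ℝ => tensor f h q.2 *
      ((Complex.exp (-((ε - Complex.I * sep m q.2) * q.1)) - Complex.exp (-(q.1 : ℂ))) / q.1))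
      ((volume.restrict (Set.Ioi 0)).prod volume) := by
  have hs := continuous_sep m
  have ht := continuous_tensor f h
  have hb := (integrableOn_exp_neg_mul (lt_min hε one_pos)).mul_prod
    ((hf.integrable_x_weight_tensor hh 1).const_mul (ε + 1))
  refine hb.mono' (Measurable.aestronglyMeasurable ?_) ?_
  · have h1 : Measurable fun q : ℝ × ℝ × ℝ => tensor f h q.2 := ht.measurable.comp measurable_snd
    have h2 : Measurable fun q : ℝ × ℝ × ℝ => sep m q.2 := hs.measurable.comp measurable_snd
    fun_prop
  · filter_upwards [ae_fst_pos] with q hq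
    rw [norm_mul]
    have h1 := norm_exp_sub_exp_div_le (z := ε - Complex.I * sep m q.2) (c := min ε 1)
      (by simp) (min_le_right _ _) hq
    have h2 : ‖(ε - Complex.I * sep m q.2 - 1 : ℂ)‖ ≤
        (ε + 1) * ((1 + |m.x q.2.1|) * (1 + |m.x q.2.2|)) := by
      have h3 : ‖(ε - Complex.I * sep m q.2 - 1 : ℂ)‖ ≤ ε + |sep m q.2| + 1 := by
        refine (norm_sub_le _ _).trans ?_
        rw [norm_one]
        gcongr
        refine (norm_sub_le _ _).trans ?_
        rw [norm_mul, Complex.norm_I, one_mul, Complex.norm_real, Complex.norm_real,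
          Real.norm_of_nonneg hε.le, Real.norm_eq_abs]
      have h4 := abs_sep_le m q.2
      have h5 := abs_nonneg (sep m q.2)
      nlinarith
    calc _ ≤ ‖tensor f h q.2‖ * ((ε + 1) * ((1 + |m.x q.2.1|) * (1 + |m.x q.2.2|)) *
          Real.exp (-(min ε 1 * q.1))) := by
          gcongr
          refine h1.trans ?_
          gcongr
      _ = _ := by ring

theorem integral_exp_mul_vacuumDensity (hf : Adapted m f) (hh : Adapted m h) {ε : ℝ}
    (hε : 0 < ε) :
    ∫ k in Set.Ioi 0, (Real.exp (-(ε * k)) : ℂ) * vacuumDensity m f h k =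
      -((4 * Real.pi)⁻¹ : ℝ) * ∫ p, tensor f h p * Complex.log (ε - Complex.I * sep m p) := by
  rw [setIntegral_congr_fun measurableSet_Ioi fun k hk => exp_mul_vacuumDensity hf.1 ε hk,
    integral_const_mul, integral_integral_swap (integrable_vacuum_kernel hf hh hε)]
  simp_rw [integral_const_mul]
  rw [neg_mul, ← mul_neg, ← integral_neg]
  congr 1
  refine integral_congr_ae (.of_forall fun p => ?_)
  simp only
  rw [integral_exp_sub_exp_div (by simpa using hε), mul_neg]

theorem norm_log_sub_I_mul_le {ε s : ℝ} (hε : 0 < ε) (hε1 : ε < 1) (hs : s ≠ 0) :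
    ‖Complex.log (ε - Complex.I * s)‖ ≤ |Real.log s| + (|s| + Real.pi) := by
  have hn : |s| ≤ ‖(ε - Complex.I * s : ℂ)‖ := by
    simpa using Complex.abs_im_le_norm (ε - Complex.I * s : ℂ)
  have hn2 : ‖(ε - Complex.I * s : ℂ)‖ ≤ 1 + |s| := by
    refine (norm_sub_le _ _).trans ?_
    rw [norm_mul, Complex.norm_I, one_mul, Complex.norm_real, Complex.norm_real,
      Real.norm_of_nonneg hε.le, Real.norm_eq_abs]
    gcongr
  have hs0 : 0 < |s| := abs_pos.2 hs
  have h1 : Real.log |s| ≤ Real.log ‖(ε - Complex.I * s : ℂ)‖ := Real.log_le_log hs0 hn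
  have h2 : Real.log ‖(ε - Complex.I * s : ℂ)‖ ≤ |s| := by
    linarith [Real.log_le_sub_one_of_pos (hs0.trans_le hn)]
  rw [Real.log_abs] at h1
  refine (Complex.norm_le_abs_re_add_abs_im _).trans ?_
  rw [Complex.log_re, Complex.log_im, ← add_assoc]
  refine add_le_add (abs_le.2 ⟨?_, ?_⟩) (Complex.abs_arg_le_pi _)
  · linarith [neg_abs_le (Real.log s)]
  · linarith [abs_nonneg (Real.log s)]

/-- On the principal branch the offset is the same constant for both signs of `s`, hence invisible
to test functions of zero integral. -/
theorem log_neg_I_mul {s : ℝ} (hs : s ≠ 0) :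
    Complex.log (-(Complex.I * s)) = Complex.log s - Complex.I * (Real.pi / 2) := by
  rcases hs.lt_or_gt with h | h
  · rw [show -(Complex.I * (s : ℂ)) = ((-s : ℝ) : ℂ) * Complex.I by push_cast; ring,
      Complex.log_ofReal_mul (by linarith) Complex.I_ne_zero, Complex.log_I,
      show (s : ℂ) = ((-s : ℝ) : ℂ) * (-1 : ℂ) by push_cast; ring,
      Complex.log_ofReal_mul (by linarith) (by norm_num), Complex.log_neg_one]
    ring
  · rw [show -(Complex.I * (s : ℂ)) = (s : ℂ) * -Complex.I by ring,
      Complex.log_ofReal_mul h (by simp), Complex.log_neg_I, Complex.ofReal_log h.le]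
    ring

theorem Adapted.integrable_tensor_mul_clog_sep (hf : Adapted m f) (hh : Adapted m h) :
    Integrable fun p => tensor f h p * Complex.log (sep m p) := by
  have hs := continuous_sep m
  refine ((hf.integrable_tensor_mul_log_sep hh).add
    ((integrable_tensor f h).norm.mul_const Real.pi)).mono'
    ((continuous_tensor f h).measurable.mul (by fun_prop)).aestronglyMeasurable
    (.of_forall fun p => ?_)
  rw [norm_mul, Pi.add_apply, ← mul_add]
  gcongr
  refine (Complex.norm_le_abs_re_add_abs_im _).trans ?_
  rw [Complex.log_re, Complex.log_im, Complex.norm_real, Real.norm_eq_abs, Real.log_abs]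
  gcongr
  exact Complex.abs_arg_le_pi _

/-- The damping is removed on both sides by dominated convergence: the density itself dominates in
momentum space, and `|log |s|| + |s| + π`, weighted by the test functions, in position space. -/
theorem integral_vacuumDensity (hf : Adapted m f) (hh : Adapted m h) :
    ∫ k in Set.Ioi 0, vacuumDensity m f h k =
      -((4 * Real.pi)⁻¹ : ℝ) * ∫ p, tensor f h p * Complex.log (sep m p) := by
  obtain ⟨A, hA, hA'⟩ := exists_norm_vacuumDensity_le hf hh
  have hc := continuousOn_vacuumDensity m f h
  have hi := integrableOn_of_norm_le_logMajorant hc hA'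
  have hpos : ∀ᶠ ε : ℝ in 𝓝[>] 0, ε ∈ Set.Ioo (0 : ℝ) 1 := Ioo_mem_nhdsGT one_pos
  have hs := continuous_sep m
  have h1 : Tendsto (fun ε : ℝ => ∫ k in Set.Ioi 0,
      (Real.exp (-(ε * k)) : ℂ) * vacuumDensity m f h k) (𝓝[>] 0)
      (𝓝 (∫ k in Set.Ioi 0, vacuumDensity m f h k)) := by
    refine tendsto_integral_filter_of_dominated_convergence _ (.of_forall fun ε => ?_) ?_
      hi.norm (.of_forall fun k => ?_)
    · exact (Continuous.aestronglyMeasurable (by fun_prop)).mul hi.aestronglyMeasurable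
    · filter_upwards [hpos] with ε hε
      refine (ae_restrict_iff' measurableSet_Ioi).2 (.of_forall fun k hk => ?_)
      rw [norm_mul, Complex.norm_real, Real.norm_of_nonneg (Real.exp_pos _).le]
      refine mul_le_of_le_one_left (norm_nonneg _) (Real.exp_le_one_iff.2 ?_)
      have := mul_pos hε.1 hk
      linarith
    · have : Continuous fun ε : ℝ => (Real.exp (-(ε * k)) : ℂ) * vacuumDensity m f h k := by
        fun_prop
      simpa using (this.tendsto 0).mono_left nhdsWithin_le_nhds
  have h2 : Tendsto (fun ε : ℝ => ∫ p, tensor f h p * Complex.log (ε - Complex.I * sep m p))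
      (𝓝[>] 0) (𝓝 (∫ p, tensor f h p * Complex.log (-(Complex.I * sep m p)))) := by
    refine tendsto_integral_filter_of_dominated_convergence
      (fun p => ‖tensor f h p‖ * |Real.log (sep m p)| +
        (‖tensor f h p‖ * ((1 + |m.x p.1|) ^ 1 * (1 + |m.x p.2|) ^ 1) +
          ‖tensor f h p‖ * Real.pi)) (.of_forall fun ε => ?_) ?_
      ((hf.integrable_tensor_mul_log_sep hh).add ((hf.integrable_x_weight_tensor hh 1).add
        ((integrable_tensor f h).norm.mul_const Real.pi))) ?_
    · exact ((continuous_tensor f h).measurable.mul (by fun_prop)).aestronglyMeasurable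
    · filter_upwards [hpos] with ε hε
      filter_upwards [ae_ne] with p hp
      rw [norm_mul, ← mul_add, ← mul_add]
      gcongr
      refine (norm_log_sub_I_mul_le hε.1 hε.2 (sep_ne_zero m hp)).trans ?_
      have := abs_sep_le m p
      rw [pow_one, pow_one]
      linarith
    · filter_upwards [ae_ne] with p hp
      refine Tendsto.const_mul _ ?_
      have hslit : -(Complex.I * sep m p) ∈ Complex.slitPlane :=
        Or.inr (by simpa using sep_ne_zero m hp)
      refine (continuousAt_clog hslit).tendsto.comp ?_
      have : Continuous fun ε : ℝ => (ε - Complex.I * sep m p : ℂ) := by fun_prop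
      simpa using (this.tendsto 0).mono_left nhdsWithin_le_nhds
  have h3 : ∫ p, tensor f h p * Complex.log (-(Complex.I * sep m p)) =
      ∫ p, tensor f h p * Complex.log (sep m p) := by
    have : ∫ p, tensor f h p * Complex.log (-(Complex.I * sep m p)) =
        ∫ p, (tensor f h p * Complex.log (sep m p) -
          tensor f h p * (Complex.I * (Real.pi / 2))) := by
      refine integral_congr_ae ?_
      filter_upwards [ae_ne] with p hp
      rw [log_neg_I_mul (sep_ne_zero m hp), mul_sub]
    rw [this, integral_sub (hf.integrable_tensor_mul_clog_sep hh)
      ((integrable_tensor f h).mul_const _), integral_mul_const, integral_tensor hf.1, zero_mul,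
      sub_zero]
  rw [← h3]
  refine tendsto_nhds_unique h1 ((h2.const_mul _).congr' ?_)
  filter_upwards [self_mem_nhdsWithin] with ε hε
  exact (integral_exp_mul_vacuumDensity hf hh hε).symm

end Vacuum

/-! ### The excited part in position space -/

section Excited

variable {m : Model} {f h : 𝓢(ℝ, ℂ)} {β : ℝ}

/-- The momenta `k` and `-k` combine into `2 cos (k s)`. Replacing `cos` by `cos - 1` is free by
zero integral and removes the singularity at `k = 0`. -/
theorem excitedDensity_eq (hf : ∫ y, f y = 0) {k : ℝ} (hk : 0 < k) :
    excitedDensity m β f h k = -((4 * Real.pi)⁻¹ : ℝ) * ∫ p, tensor f h p *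
      ((2 / k * (1 - Real.cos (k * sep m p)) * bose (β * k) : ℝ) : ℂ) := by
  have hk' : (k : ℂ) ≠ 0 := by exact_mod_cast hk.ne'
  have h1 (p : ℝ × ℝ) : tensor f h p *
      ((2 / k * (1 - Real.cos (k * sep m p)) * bose (β * k) : ℝ) : ℂ) =
      ((2 / k * bose (β * k) : ℝ) : ℂ) * tensor f h p - ((k⁻¹ * bose (β * k) : ℝ) : ℂ) *
        (tensor f h p * Complex.exp (Complex.I * k * sep m p) +
          tensor f h p * Complex.exp (Complex.I * (-k : ℝ) * sep m p)) := by
    have : ((Real.cos (k * sep m p) : ℝ) : ℂ) = (Complex.exp (Complex.I * k * sep m p) +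
        Complex.exp (Complex.I * (-k : ℝ) * sep m p)) / 2 := by
      push_cast
      rw [Complex.cos]
      congr 3 <;> ring
    push_cast at this ⊢
    rw [this]
    field_simp
  have hadd : Integrable fun p => tensor f h p * Complex.exp (Complex.I * k * sep m p) +
      tensor f h p * Complex.exp (Complex.I * (-k : ℝ) * sep m p) :=
    (integrable_tensor_mul_exp m f h k).add (integrable_tensor_mul_exp m f h (-k))
  simp_rw [h1]
  rw [integral_sub ((integrable_tensor f h).const_mul _) (hadd.const_mul _),
    integral_const_mul, integral_const_mul, integral_tensor hf, mul_zero, zero_sub,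
    integral_add (integrable_tensor_mul_exp m f h k) (integrable_tensor_mul_exp m f h (-k)),
    excitedDensity, amplitude_mul_star_eq, amplitude_mul_star_eq]
  push_cast
  field_simp
  ring

theorem integrable_excited_kernel (hβ : 0 < β) (hf : Adapted m f) (hh : Adapted m h) :
    Integrable (fun q : ℝ × ℝ × ℝ => tensor f h q.2 *
      ((2 / q.1 * (1 - Real.cos (q.1 * sep m q.2)) * bose (β * q.1) : ℝ) : ℂ))
      ((volume.restrict (Set.Ioi 0)).prod volume) := by
  have hs := continuous_sep m
  have ht := continuous_tensor f h
  have hb := ((integrableOn_exp_neg_mul (half_pos hβ)).const_mul β⁻¹).mul_prod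
    (hf.integrable_x_weight_tensor hh 2)
  refine hb.mono' (Measurable.aestronglyMeasurable ?_) ?_
  · have h1 : Measurable fun q : ℝ × ℝ × ℝ => tensor f h q.2 := ht.measurable.comp measurable_snd
    have h2 : Measurable fun q : ℝ × ℝ × ℝ => sep m q.2 := hs.measurable.comp measurable_snd
    unfold bose
    fun_prop
  · filter_upwards [ae_fst_pos] with q hq
    rw [norm_mul, Complex.norm_real, Real.norm_of_nonneg (shift_integrand_nonneg hβ hq _)]
    have h1 : sep m q.2 ^ 2 ≤ (1 + |m.x q.2.1|) ^ 2 * (1 + |m.x q.2.2|) ^ 2 := by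
      rw [← mul_pow, ← sq_abs]
      gcongr
      linarith [abs_sep_le m q.2]
    calc _ ≤ ‖tensor f h q.2‖ * (((1 + |m.x q.2.1|) ^ 2 * (1 + |m.x q.2.2|) ^ 2) *
          (β⁻¹ * Real.exp (-(β / 2 * q.1)))) := by
          refine mul_le_mul_of_nonneg_left ((shift_integrand_le hβ hq _).trans ?_) (norm_nonneg _)
          gcongr
      _ = _ := by ring

theorem integrable_tensor_mul_thermalShift (hβ : 0 < β) (hf : Adapted m f) (hh : Adapted m h) :
    Integrable fun p => tensor f h p * (thermalShift β (sep m p) : ℂ) := by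
  refine (integrable_excited_kernel hβ hf hh).integral_prod_right.congr (.of_forall fun p => ?_)
  simp only
  rw [integral_const_mul, integral_complex_ofReal]
  rfl

theorem integral_excitedDensity (hβ : 0 < β) (hf : Adapted m f) (hh : Adapted m h) :
    ∫ k in Set.Ioi 0, excitedDensity m β f h k =
      -((4 * Real.pi)⁻¹ : ℝ) * ∫ p, tensor f h p * (thermalShift β (sep m p) : ℂ) := by
  rw [setIntegral_congr_fun measurableSet_Ioi fun k hk => excitedDensity_eq hf.1 hk,
    integral_const_mul, integral_integral_swap (integrable_excited_kernel hβ hf hh)]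
  simp_rw [integral_const_mul, integral_complex_ofReal]
  rfl

end Excited

/-- The thermal two-point function as an integral over the outgoing coordinates. -/
theorem thermalInTwoPt_integral (t : FieldType) {m : Model} {β : ℝ} (hβ : 0 < β) {f h : 𝓢(ℝ, ℂ)}
    (hf : Adapted m f) (hh : Adapted m h) :
    thermalInTwoPt t m β f h (-((4 * Real.pi)⁻¹ : ℝ) * ∫ p, tensor f h p *
      (Complex.log (sep m p) + (thermalShift β (sep m p) : ℂ))) := by
  have := thermalInTwoPt_of_adapted t hβ hf hh
  rwa [integral_vacuumDensity hf hh, integral_excitedDensity hβ hf hh, ← mul_add,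
    ← integral_add (hf.integrable_tensor_mul_clog_sep hh)
      (integrable_tensor_mul_thermalShift hβ hf hh), integral_congr_ae
    (.of_forall fun p => (mul_add (tensor f h p) _ _).symm)] at this

/-! ### Boundary values of the outgoing thermal kernel -/

section Kernel

variable {β : ℝ}

theorem norm_sinh_le (z : ℂ) : ‖Complex.sinh z‖ ≤ Real.exp |z.re| := by
  rw [Complex.sinh, norm_div, Complex.norm_two, div_le_iff₀ two_pos]
  refine (norm_sub_le _ _).trans ?_
  rw [Complex.norm_exp, Complex.norm_exp, Complex.neg_re]
  linarith [Real.exp_le_exp.2 (le_abs_self z.re), Real.exp_le_exp.2 (neg_le_abs z.re)]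

theorem abs_sinh_re_le_norm_sinh (z : ℂ) : |Real.sinh z.re| ≤ ‖Complex.sinh z‖ := by
  rw [Complex.sinh, norm_div, Complex.norm_two, Real.sinh_eq, abs_div, abs_two]
  gcongr
  have := abs_norm_sub_norm_le (Complex.exp z) (Complex.exp (-z))
  rwa [Complex.norm_exp, Complex.norm_exp, Complex.neg_re] at this

theorem abs_le_abs_sinh (a : ℝ) : |a| ≤ |Real.sinh a| := by
  rw [Real.abs_sinh]
  exact Real.self_le_sinh_iff.2 (abs_nonneg a)

/-- The argument of the logarithm in the thermal kernel. -/
def sinhKernel (β : ℝ) (z : ℂ) : ℂ :=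
  ((β / Real.pi : ℝ) : ℂ) * Complex.sinh (((Real.pi / β : ℝ) : ℂ) * z)

theorem continuous_sinhKernel (β : ℝ) : Continuous (sinhKernel β) := by
  unfold sinhKernel
  fun_prop

theorem thermalKernel_eq (β : ℝ) (z : ℂ) :
    thermalKernel β z = -((4 * Real.pi)⁻¹ : ℝ) * Complex.log (sinhKernel β z) := by
  rw [thermalKernel, sinhKernel]
  push_cast
  rw [one_div]

theorem sinhKernel_ofReal (β t : ℝ) :
    sinhKernel β t = ((β / Real.pi * Real.sinh (Real.pi / β * t) : ℝ) : ℂ) := by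
  rw [sinhKernel]
  push_cast
  rfl

/-- Since `|sinh z| ≥ |sinh (Re z)| ≥ |Re z|`, the bound is uniform in `ε` and allows dominated
convergence. -/
theorem norm_log_sinhKernel_le (hβ : 0 < β) (t ε : ℝ) (ht : t ≠ 0) :
    ‖Complex.log (sinhKernel β (t + Complex.I * ε))‖ ≤
      |Real.log t| + (|Real.log (β / Real.pi)| + Real.pi / β * |t| + Real.pi) := by
  have hπ := Real.pi_pos
  have hre : (((Real.pi / β : ℝ) : ℂ) * (t + Complex.I * ε)).re = Real.pi / β * t := by
    simp
  have hnorm : ‖sinhKernel β (t + Complex.I * ε)‖ =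
      β / Real.pi * ‖Complex.sinh (((Real.pi / β : ℝ) : ℂ) * (t + Complex.I * ε))‖ := by
    rw [sinhKernel, norm_mul, Complex.norm_real, Real.norm_of_nonneg (by positivity)]
  have h1 : |t| ≤ ‖sinhKernel β (t + Complex.I * ε)‖ := by
    rw [hnorm]
    have h2 := abs_sinh_re_le_norm_sinh (((Real.pi / β : ℝ) : ℂ) * (t + Complex.I * ε))
    rw [hre] at h2
    have h3 := (abs_le_abs_sinh (Real.pi / β * t)).trans h2
    rw [abs_mul, abs_of_pos (by positivity)] at h3
    calc |t| = β / Real.pi * (Real.pi / β * |t|) := by field_simp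
      _ ≤ _ := by gcongr
  have h2 : ‖sinhKernel β (t + Complex.I * ε)‖ ≤
      β / Real.pi * Real.exp (Real.pi / β * |t|) := by
    rw [hnorm]
    gcongr
    have := norm_sinh_le (((Real.pi / β : ℝ) : ℂ) * (t + Complex.I * ε))
    rwa [hre, abs_mul, abs_of_pos (by positivity)] at this
  have ht0 : 0 < |t| := abs_pos.2 ht
  have h3 := Real.log_le_log ht0 h1
  have h4 := Real.log_le_log (ht0.trans_le h1) h2
  rw [Real.log_abs] at h3
  rw [Real.log_mul (by positivity) (by positivity), Real.log_exp] at h4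
  refine (Complex.norm_le_abs_re_add_abs_im _).trans ?_
  rw [Complex.log_re, Complex.log_im, ← add_assoc]
  refine add_le_add (abs_le.2 ⟨?_, ?_⟩) (Complex.abs_arg_le_pi _)
  · have : 0 ≤ Real.pi / β * |t| := by positivity
    linarith [neg_abs_le (Real.log t), abs_nonneg (Real.log (β / Real.pi))]
  · linarith [abs_nonneg (Real.log t), le_abs_self (Real.log (β / Real.pi))]

theorem sinhKernel_im (β t ε : ℝ) : (sinhKernel β (t + Complex.I * ε)).im =
    β / Real.pi * (Real.cosh (Real.pi / β * t) * Real.sin (Real.pi / β * ε)) := by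
  rw [sinhKernel, Complex.im_ofReal_mul, mul_add, mul_left_comm, mul_comm Complex.I,
    ← Complex.ofReal_mul, ← Complex.ofReal_mul, Complex.sinh_add, Complex.sinh_mul_I,
    Complex.cosh_mul_I, ← Complex.ofReal_sinh, ← Complex.ofReal_cosh, ← Complex.ofReal_sin,
    ← Complex.ofReal_cos]
  generalize Real.pi / β * t = a
  generalize Real.pi / β * ε = b
  congr 1
  simp only [Complex.add_im, Complex.mul_im, Complex.mul_re, Complex.ofReal_re, Complex.ofReal_im,
    Complex.I_re, Complex.I_im]
  ring

/-- For `t < 0` the limit point lies on the branch cut, but for `0 < ε < β` it is approached with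
nonnegative imaginary part, where the principal logarithm is continuous. -/
theorem tendsto_log_sinhKernel (hβ : 0 < β) {t : ℝ} (ht : t ≠ 0) :
    Tendsto (fun ε : ℝ => Complex.log (sinhKernel β (t + Complex.I * ε))) (𝓝[>] 0)
      (𝓝 (Complex.log (sinhKernel β t))) := by
  have hπ := Real.pi_pos
  have hc : Tendsto (fun ε : ℝ => sinhKernel β (t + Complex.I * ε)) (𝓝[>] 0)
      (𝓝 (sinhKernel β t)) := by
    have : Continuous fun ε : ℝ => sinhKernel β (t + Complex.I * ε) :=
      (continuous_sinhKernel β).comp (by fun_prop)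
    simpa using (this.tendsto 0).mono_left nhdsWithin_le_nhds
  rcases ht.lt_or_gt with h | h
  · have hre : (sinhKernel β t).re < 0 := by
      rw [sinhKernel_ofReal, Complex.ofReal_re]
      exact mul_neg_of_pos_of_neg (by positivity)
        (Real.sinh_neg_iff.2 (mul_neg_of_pos_of_neg (by positivity) h))
    have him : (sinhKernel β t).im = 0 := by
      rw [sinhKernel_ofReal, Complex.ofReal_im]
    refine (Complex.continuousWithinAt_log_of_re_neg_of_im_zero hre him).tendsto.comp
      (tendsto_nhdsWithin_iff.2 ⟨hc, ?_⟩)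
    filter_upwards [Ioo_mem_nhdsGT hβ] with ε hε
    rw [sinhKernel_im]
    have : 0 ≤ Real.sin (Real.pi / β * ε) := by
      have := hε.1
      refine Real.sin_nonneg_of_nonneg_of_le_pi (by positivity) ?_
      rw [div_mul_eq_mul_div, div_le_iff₀ hβ]
      gcongr
      exact hε.2.le
    have := Real.cosh_pos (Real.pi / β * t)
    positivity
  · refine (continuousAt_clog (Or.inl ?_)).tendsto.comp hc
    rw [sinhKernel_ofReal, Complex.ofReal_re]
    exact mul_pos (by positivity) (Real.sinh_pos_iff.2 (by positivity))

theorem integrable_kernel_bound (f h : 𝓢(ℝ, ℂ)) (β : ℝ) :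
    Integrable fun p : ℝ × ℝ => ‖tensor f h p‖ * (|Real.log (p.2 - p.1)| +
      (|Real.log (β / Real.pi)| + Real.pi / β * |p.2 - p.1| + Real.pi)) := by
  have h1 : Integrable fun p : ℝ × ℝ => ‖tensor f h p‖ * |p.2 - p.1| := by
    have ht := continuous_tensor f h
    refine (integrable_weight_tensor f h 1).mono' (Continuous.aestronglyMeasurable (by fun_prop))
      (.of_forall fun p => ?_)
    rw [Real.norm_of_nonneg (by positivity)]
    gcongr
    have := abs_sub p.2 p.1
    have := mul_nonneg (abs_nonneg p.1) (abs_nonneg p.2)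
    linarith
  refine (((integrable_tensor_mul_log f h).add (h1.const_mul (Real.pi / β))).add
    ((integrable_tensor f h).norm.mul_const (|Real.log (β / Real.pi)| + Real.pi))).congr
    (.of_forall fun p => ?_)
  simp only [Pi.add_apply]
  ring

theorem integrable_tensor_mul_log_sinhKernel (hβ : 0 < β) (f h : 𝓢(ℝ, ℂ)) (ε : ℝ) :
    Integrable fun p : ℝ × ℝ => tensor f h p *
      Complex.log (sinhKernel β (((p.2 - p.1 : ℝ) : ℂ) + Complex.I * ε)) := by
  have hk := (continuous_sinhKernel β).measurable
  refine (integrable_kernel_bound f h β).mono'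
    ((continuous_tensor f h).measurable.mul (by fun_prop)).aestronglyMeasurable ?_
  filter_upwards [ae_ne] with p hp
  rw [norm_mul]
  gcongr
  exact norm_log_sinhKernel_le hβ _ ε (sub_ne_zero.2 hp.symm)

/-- The outgoing thermal two-point function as an integral against its boundary value. -/
theorem thermalOutTwoPt_integral (hβ : 0 < β) (f h : 𝓢(ℝ, ℂ)) :
    thermalOutTwoPt β f h (-((4 * Real.pi)⁻¹ : ℝ) * ∫ p : ℝ × ℝ, tensor f h p *
      Complex.log (sinhKernel β ((p.2 - p.1 : ℝ) : ℂ))) := by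
  have hk := (continuous_sinhKernel β).measurable
  have hlim : Tendsto (fun ε : ℝ => ∫ p : ℝ × ℝ, tensor f h p *
      Complex.log (sinhKernel β (((p.2 - p.1 : ℝ) : ℂ) + Complex.I * ε))) (𝓝[>] 0)
      (𝓝 (∫ p : ℝ × ℝ, tensor f h p * Complex.log (sinhKernel β ((p.2 - p.1 : ℝ) : ℂ)))) := by
    refine tendsto_integral_filter_of_dominated_convergence _ (.of_forall fun ε =>
      (integrable_tensor_mul_log_sinhKernel hβ f h ε).aestronglyMeasurable) (.of_forall fun ε => ?_)
      (integrable_kernel_bound f h β) ?_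
    · filter_upwards [ae_ne] with p hp
      rw [norm_mul]
      gcongr
      exact norm_log_sinhKernel_le hβ _ ε (sub_ne_zero.2 hp.symm)
    · filter_upwards [ae_ne] with p hp
      exact (tendsto_log_sinhKernel hβ (sub_ne_zero.2 hp.symm)).const_mul _
  refine (hlim.const_mul _).congr fun ε => ?_
  rw [← integral_const_mul, Measure.volume_eq_prod, integral_prod]
  · refine integral_congr_ae (.of_forall fun y => integral_congr_ae (.of_forall fun z => ?_))
    simp only [tensor]
    rw [thermalKernel_eq]
    push_cast
    ring
  · exact (integrable_tensor_mul_log_sinhKernel hβ f h ε).const_mul _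

end Kernel

/-! ### Comparison of the kernels in the two asymptotic regions -/

section Comparison

/-- The kernels need to be close only modulo `a(y) + b(y')`, and only where the test functions live.
The prefactor `1/(4π)` is bounded by 1. -/
theorem norm_integral_tensor_sub_le {f h : 𝓢(ℝ, ℂ)} (hf : ∫ y, f y = 0) (hh : ∫ y, h y = 0)
    {K L : ℝ × ℝ → ℂ} (hK : Integrable fun p => tensor f h p * K p)
    (hL : Integrable fun p => tensor f h p * L p) (a b : ℝ → ℂ)
    (ha : Integrable fun p => tensor f h p * a p.1) (hb : Integrable fun p => tensor f h p * b p.2)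
    {η : ℝ} (hη : ∀ᵐ p : ℝ × ℝ, f p.1 ≠ 0 → h p.2 ≠ 0 → ‖K p - L p + (a p.1 + b p.2)‖ ≤ η) :
    ‖-((4 * Real.pi)⁻¹ : ℝ) * (∫ p, tensor f h p * K p) -
      -((4 * Real.pi)⁻¹ : ℝ) * ∫ p, tensor f h p * L p‖ ≤
        η * (∫ y, ‖f y‖) * ∫ y, ‖h y‖ := by
  have h1 : (∫ p, tensor f h p * K p) - (∫ p, tensor f h p * L p) =
      ∫ p, tensor f h p * (K p - L p + (a p.1 + b p.2)) := by
    have h2 : ∫ p, (tensor f h p * a p.1 + tensor f h p * b p.2) = 0 := by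
      rw [integral_add ha hb, integral_tensor_fst hh, integral_tensor_snd hf, add_zero]
    have hab : Integrable fun p => tensor f h p * a p.1 + tensor f h p * b p.2 := ha.add hb
    have hKL : Integrable fun p => tensor f h p * K p - tensor f h p * L p := hK.sub hL
    rw [← integral_sub hK hL, ← add_zero (∫ p, _), ← h2, ← integral_add hKL hab]
    refine integral_congr_ae (.of_forall fun p => ?_)
    ring
  have h2 : ‖∫ p, tensor f h p * (K p - L p + (a p.1 + b p.2))‖ ≤
      ∫ p, η * ‖tensor f h p‖ := by
    refine norm_integral_le_of_norm_le ((integrable_tensor f h).norm.const_mul η) ?_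
    filter_upwards [hη] with p hp
    by_cases h0 : tensor f h p = 0
    · simp [h0]
    · rw [norm_mul, mul_comm]
      gcongr
      refine hp (fun h' => h0 ?_) (fun h' => h0 ?_) <;> simp [tensor, h']
  have h3 : ∫ p, ‖tensor f h p‖ = (∫ y, ‖f y‖) * ∫ y, ‖h y‖ := by
    rw [← integral_prod_mul]
    simp [tensor, Measure.volume_eq_prod]
  rw [integral_const_mul, h3] at h2
  have h4 : ‖-(((4 * Real.pi)⁻¹ : ℝ) : ℂ)‖ ≤ 1 := by
    rw [norm_neg, Complex.norm_real, Real.norm_of_nonneg (by positivity)]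
    refine inv_le_one_of_one_le₀ ?_
    linarith [Real.pi_gt_three]
  rw [← mul_sub, h1, norm_mul, mul_assoc]
  exact (mul_le_of_le_one_left (norm_nonneg _) h4).trans h2

theorem integrable_tensor_mul_half_fst (f h : 𝓢(ℝ, ℂ)) :
    Integrable fun p : ℝ × ℝ => tensor f h p * ((p.1 / 2 : ℝ) : ℂ) := by
  have ht := continuous_tensor f h
  refine (integrable_weight_tensor f h 1).mono' (Continuous.aestronglyMeasurable (by fun_prop))
    (.of_forall fun p => ?_)
  rw [norm_mul, Complex.norm_real, Real.norm_eq_abs, abs_div, abs_two]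
  gcongr
  nlinarith [abs_nonneg p.1, abs_nonneg p.2]

theorem integrable_tensor_mul_half_snd (f h : 𝓢(ℝ, ℂ)) :
    Integrable fun p : ℝ × ℝ => tensor f h p * ((p.2 / 2 : ℝ) : ℂ) := by
  have ht := continuous_tensor f h
  refine (integrable_weight_tensor f h 1).mono' (Continuous.aestronglyMeasurable (by fun_prop))
    (.of_forall fun p => ?_)
  rw [norm_mul, Complex.norm_real, Real.norm_eq_abs, abs_div, abs_two]
  gcongr
  nlinarith [abs_nonneg p.1, abs_nonneg p.2]

theorem Adapted.integrable_tensor_mul_thermal {m : Model} {β : ℝ} {f h : 𝓢(ℝ, ℂ)} (hβ : 0 < β)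
    (hf : Adapted m f) (hh : Adapted m h) : Integrable fun p => tensor f h p *
      (Complex.log (sep m p) + (thermalShift β (sep m p) : ℂ)) := by
  simp_rw [mul_add]
  exact (hf.integrable_tensor_mul_clog_sep hh).add (integrable_tensor_mul_thermalShift hβ hf hh)

theorem exists_exp_neg_le (C : ℝ) {ε : ℝ} (hε : 0 < ε) :
    ∃ R : ℝ, 0 ≤ R ∧ Real.exp (-R) ≤ 1 / 2 ∧ C * Real.exp (-R) ≤ ε := by
  have h1 : Tendsto (fun R => Real.exp (-R)) atTop (𝓝 0) :=
    Real.tendsto_exp_atBot.comp tendsto_neg_atTop_atBot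
  have h2 : Tendsto (fun R => C * Real.exp (-R)) atTop (𝓝 0) := by
    simpa using h1.const_mul C
  obtain ⟨R, h⟩ := ((eventually_ge_atTop 0).and ((h1.eventually_le_const
    (show (0 : ℝ) < 1 / 2 by norm_num)).and
    (h2.eventually_le_const hε))).exists
  exact ⟨R, h⟩

theorem Model.cghs_x_eq (y : ℝ) : Model.cghs.x y = y - Real.log (1 + Real.exp y) := by
  have : 1 + Real.exp (-y) = (1 + Real.exp y) / Real.exp y := by
    rw [Real.exp_neg]
    field_simp
    ring
  rw [Model.x, this, Real.log_div (by positivity) (by positivity), Real.log_exp]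
  ring

theorem log_one_add_exp_mem (y : ℝ) :
    0 ≤ Real.log (1 + Real.exp y) ∧ Real.log (1 + Real.exp y) ≤ Real.exp y := by
  have := Real.exp_pos y
  refine ⟨Real.log_nonneg (by linarith), ?_⟩
  linarith [Real.log_le_sub_one_of_pos (show 0 < 1 + Real.exp y by positivity)]

theorem adapted_of_support_subset_Ici (m : Model) {R : ℝ} (hR : 0 ≤ R) {f : 𝓢(ℝ, ℂ)}
    (hf : f ∈ S0) (hs : Function.support f ⊆ Set.Ici R) : Adapted m f := by
  refine ⟨hf, 1, fun y hy => ?_⟩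
  have hy0 : R ≤ y := hs hy
  have h1 : Real.exp (-y) ≤ 1 := Real.exp_le_one_iff.2 (by linarith)
  have h2 := log_one_add_exp_mem (-y)
  have h3 := abs_nonneg y
  cases m
  · rw [Model.x, abs_neg, abs_of_pos (Real.exp_pos _)]
    linarith
  · rw [Model.x, abs_neg, abs_of_nonneg h2.1]
    linarith

theorem adapted_of_support_subset_Iic {R : ℝ} (hR : 0 ≤ R) {f : 𝓢(ℝ, ℂ)}
    (hf : f ∈ S0) (hs : Function.support f ⊆ Set.Iic (-R)) : Adapted .cghs f := by
  refine ⟨hf, 1, fun y hy => ?_⟩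
  have hy0 : y ≤ -R := hs hy
  have h1 : Real.exp y ≤ 1 := Real.exp_le_one_iff.2 (by linarith)
  have h2 := log_one_add_exp_mem y
  rw [Model.cghs_x_eq]
  refine (abs_sub _ _).trans ?_
  rw [abs_of_nonneg h2.1]
  linarith

theorem log_one_add_sub_mem {a b : ℝ} (ha : 0 < a) (hab : a ≤ b) :
    (b - a) / (1 + b) ≤ Real.log (1 + b) - Real.log (1 + a) ∧
      Real.log (1 + b) - Real.log (1 + a) ≤ (b - a) / (1 + a) := by
  have hb : 0 < b := ha.trans_le hab
  have h1 := Real.log_le_sub_one_of_pos (show 0 < (1 + b) / (1 + a) by positivity)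
  have h2 := Real.log_le_sub_one_of_pos (show 0 < (1 + a) / (1 + b) by positivity)
  rw [Real.log_div (by positivity) (by positivity)] at h1 h2
  have h3 : (1 + b) / (1 + a) - 1 = (b - a) / (1 + a) := by
    field_simp
    ring
  have h4 : (1 + a) / (1 + b) - 1 = -((b - a) / (1 + b)) := by
    field_simp
    ring
  constructor <;> linarith

/-- Difference quotients of `log (1 + ·)` on `(0, ρ]` lie between `1 / (1 + ρ)` and 1, and `log (1 +
ρ) ≤ ρ`. -/
theorem exists_log_one_add_sub_eq {a b ρ : ℝ} (ha : 0 < a) (hb : 0 < b) (haρ : a ≤ ρ)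
    (hbρ : b ≤ ρ) :
    ∃ r, 0 < r ∧ |Real.log r| ≤ ρ ∧ Real.log (1 + b) - Real.log (1 + a) = r * (b - a) := by
  wlog hab : a ≤ b generalizing a b
  · obtain ⟨r, h1, h2, h3⟩ := this hb ha hbρ haρ (le_of_not_ge hab)
    exact ⟨r, h1, h2, by linarith⟩
  rcases hab.eq_or_lt with rfl | hlt
  · exact ⟨1, one_pos, by simpa using ha.le.trans haρ, by simp⟩
  have hd : 0 < b - a := sub_pos.2 hlt
  have hρ : 0 < ρ := ha.trans_le haρ
  obtain ⟨h1, h2⟩ := log_one_add_sub_mem ha hab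
  set r := (Real.log (1 + b) - Real.log (1 + a)) / (b - a) with hr
  have hr1 : (1 + ρ)⁻¹ ≤ r := by
    rw [hr, le_div_iff₀ hd, inv_mul_eq_div]
    refine le_trans ?_ h1
    gcongr
  have hr2 : r ≤ 1 := by
    rw [hr, div_le_one hd]
    refine h2.trans (div_le_self hd.le (by linarith))
  have hr0 : 0 < r := lt_of_lt_of_le (by positivity) hr1
  refine ⟨r, hr0, ?_, by rw [hr, div_mul_cancel₀ _ hd.ne']⟩
  rw [abs_of_nonpos (Real.log_nonpos hr0.le hr2)]
  have h3 := Real.log_le_log (by positivity) hr1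
  rw [Real.log_inv] at h3
  linarith [Real.log_le_sub_one_of_pos (show 0 < 1 + ρ by linarith)]

theorem exists_sep_eq_of_ge (m : Model) {R : ℝ} {p : ℝ × ℝ} (h1 : R ≤ p.1) (h2 : R ≤ p.2) :
    ∃ r, 0 < r ∧ |Real.log r| ≤ Real.exp (-R) ∧
      sep m p = r * (Real.exp (-p.1) - Real.exp (-p.2)) := by
  cases m
  · exact ⟨1, one_pos, by simpa using (Real.exp_pos _).le, by simp only [sep, Model.x]; ring⟩
  · obtain ⟨r, hr, hr', hr''⟩ := exists_log_one_add_sub_eq (Real.exp_pos (-p.2))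
      (Real.exp_pos (-p.1)) (Real.exp_le_exp.2 (neg_le_neg h2)) (Real.exp_le_exp.2 (neg_le_neg h1))
    refine ⟨r, hr, hr', ?_⟩
    rw [← hr'']
    simp only [sep, Model.x]
    ring

theorem abs_sep_le_of_ge (m : Model) {R : ℝ} {p : ℝ × ℝ} (h1 : R ≤ p.1) (h2 : R ≤ p.2) :
    |sep m p| ≤ Real.exp (-R) := by
  have h (y : ℝ) (hy : R ≤ y) : m.x y ≤ 0 ∧ -Real.exp (-R) ≤ m.x y := by
    have h3 : Real.exp (-y) ≤ Real.exp (-R) := Real.exp_le_exp.2 (neg_le_neg hy)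
    have h4 := log_one_add_exp_mem (-y)
    have h5 := Real.exp_pos (-y)
    cases m <;> simp only [Model.x] <;> constructor <;> linarith
  obtain ⟨h3, h4⟩ := h _ h1
  obtain ⟨h5, h6⟩ := h _ h2
  rw [sep, abs_le]
  constructor <;> linarith

/-- At `β = 2π` the outgoing kernel's argument is `2 sinh ((y'-y)/2) = e^{(y+y')/2} u`. The same
`log u`, branch included, occurs in both kernels and cancels, leaving exactly `log r` plus the
thermal shift. -/
theorem norm_kernel_sub_le_of_ge (m : Model) {β : ℝ} (hβ : 0 < β) {R : ℝ} (hR : 0 ≤ R) {p : ℝ × ℝ}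
    (h1 : R ≤ p.1) (h2 : R ≤ p.2) (hp : p.1 ≠ p.2) :
    ‖Complex.log (sep m p) + (thermalShift β (sep m p) : ℂ) -
      Complex.log (sinhKernel (2 * Real.pi) ((p.2 - p.1 : ℝ) : ℂ)) +
        (((p.1 / 2 : ℝ) : ℂ) + ((p.2 / 2 : ℝ) : ℂ))‖ ≤ (1 + 2 / β ^ 2) * Real.exp (-R) := by
  obtain ⟨r, hr, hr', hs⟩ := exists_sep_eq_of_ge m h1 h2
  set u := Real.exp (-p.1) - Real.exp (-p.2) with hu
  have hu0 : u ≠ 0 := sub_ne_zero.2 fun h => hp (neg_injective (Real.exp_injective h))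
  have hk : sinhKernel (2 * Real.pi) ((p.2 - p.1 : ℝ) : ℂ) =
      ((Real.exp (p.1 / 2 + p.2 / 2) : ℝ) : ℂ) * (u : ℂ) := by
    rw [sinhKernel_ofReal, ← Complex.ofReal_mul, hu, Real.sinh_eq, mul_sub (Real.exp _), ← Real.exp_add,
      ← Real.exp_add]
    have hπ := Real.pi_ne_zero
    have e1 : Real.pi / (2 * Real.pi) * (p.2 - p.1) = p.1 / 2 + p.2 / 2 + -p.1 := by
      field_simp
      ring
    have e2 : -(p.1 / 2 + p.2 / 2 + -p.1) = p.1 / 2 + p.2 / 2 + -p.2 := by ring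
    rw [e1, e2]
    congr 1
    field_simp
  have hu' : (u : ℂ) ≠ 0 := by exact_mod_cast hu0
  have hlog : Complex.log (sep m p) = Real.log r + Complex.log u := by
    rw [hs, Complex.ofReal_mul, Complex.log_ofReal_mul hr hu']
  rw [hk, Complex.log_ofReal_mul (Real.exp_pos _) hu', Real.log_exp, hlog]
  have hring : (Real.log r : ℂ) + Complex.log u + (thermalShift β (sep m p) : ℂ) -
      (((p.1 / 2 + p.2 / 2 : ℝ) : ℂ) + Complex.log u) +
        (((p.1 / 2 : ℝ) : ℂ) + ((p.2 / 2 : ℝ) : ℂ)) =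
      ((Real.log r + thermalShift β (sep m p) : ℝ) : ℂ) := by
    push_cast
    ring
  rw [hring, Complex.norm_real, Real.norm_eq_abs]
  have hsep := abs_sep_le_of_ge m h1 h2
  have he1 : Real.exp (-R) ≤ 1 := Real.exp_le_one_iff.2 (by linarith)
  have hsq : sep m p ^ 2 ≤ Real.exp (-R) := by
    rw [← sq_abs]
    nlinarith [abs_nonneg (sep m p)]
  have hΦ : thermalShift β (sep m p) ≤ 2 / β ^ 2 * Real.exp (-R) :=
    (thermalShift_le hβ _).trans (by gcongr)
  refine (abs_add_le _ _).trans ?_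
  rw [abs_of_nonneg (thermalShift_nonneg hβ _)]
  linarith

theorem asympEqAtTop_thermal (t : FieldType) (m : Model) {β : ℝ} (hβ : 0 < β) :
    AsympEqAtTop (thermalInTwoPt t m β) (thermalOutTwoPt (2 * Real.pi)) := by
  intro ε hε
  obtain ⟨R, hR, -, hRε⟩ := exists_exp_neg_le (1 + 2 / β ^ 2) hε
  refine ⟨R, fun f hf h hh hfs hhs => ?_⟩
  have hfa := adapted_of_support_subset_Ici m hR hf hfs
  have hha := adapted_of_support_subset_Ici m hR hh hhs
  refine ⟨_, _, thermalInTwoPt_integral t hβ hfa hha,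
    thermalOutTwoPt_integral Real.two_pi_pos f h, ?_⟩
  refine norm_integral_tensor_sub_le hf hh (hfa.integrable_tensor_mul_thermal hβ hha)
    (by simpa using integrable_tensor_mul_log_sinhKernel Real.two_pi_pos f h 0)
    (fun y => ((y / 2 : ℝ) : ℂ)) (fun y => ((y / 2 : ℝ) : ℂ)) (integrable_tensor_mul_half_fst f h)
    (integrable_tensor_mul_half_snd f h) ?_
  filter_upwards [ae_ne] with p hp h1 h2
  exact (norm_kernel_sub_le_of_ge m hβ hR (hfs h1) (hhs h2) hp).trans hRε

/-- Says that `(1 - e^{-2u}) / u` is decreasing, which follows from convexity of `exp` on the chord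
from `-2b` to 0. -/
theorem sinh_mul_le {a b : ℝ} (ha : 0 < a) (hab : a ≤ b) :
    Real.sinh b * a ≤ Real.sinh a * b * Real.exp (b - a) := by
  have hb : 0 < b := ha.trans_le hab
  have hconv := convexOn_exp.2 (Set.mem_univ (-(2 * b))) (Set.mem_univ 0)
    (div_nonneg ha.le hb.le) (sub_nonneg.2 ((div_le_one hb).2 hab)) (by ring)
  simp only [smul_eq_mul, mul_zero, add_zero, Real.exp_zero, mul_one] at hconv
  have e1 : a / b * -(2 * b) = -(2 * a) := by field_simp
  rw [e1] at hconv
  have h1 : b * Real.exp (-(2 * a)) ≤ a * Real.exp (-(2 * b)) + (b - a) := by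
    calc b * Real.exp (-(2 * a)) ≤ b * (a / b * Real.exp (-(2 * b)) + (1 - a / b)) := by gcongr
      _ = _ := by field_simp
  have e2 : Real.sinh b = Real.exp b * (1 - Real.exp (-(2 * b))) / 2 := by
    rw [Real.sinh_eq, mul_sub, ← Real.exp_add]
    ring_nf
  have e3 : Real.sinh a * Real.exp (b - a) = Real.exp b * (1 - Real.exp (-(2 * a))) / 2 := by
    rw [Real.sinh_eq, mul_sub, ← Real.exp_add, div_mul_eq_mul_div, sub_mul, ← Real.exp_add,
      ← Real.exp_add]
    ring_nf
  rw [mul_right_comm, e3, e2]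
  nlinarith [mul_le_mul_of_nonneg_left h1 (Real.exp_pos b).le]

/-- The relative error controls `t / s - 1 ≤ 2 ρ`, as `s ≥ t / 2`, and the absolute error controls
the exponent `c (t - s) ≤ c ρ`. -/
theorem exists_sinh_eq {s t c ρ : ℝ} (hc : 0 < c) (ht : 0 < t) (hρ : ρ ≤ 1 / 2)
    (hst : s ≤ t) (h1 : t - s ≤ ρ * t) (h2 : t - s ≤ ρ) :
    ∃ r, 0 < r ∧ |Real.log r| ≤ (2 + c) * ρ ∧ Real.sinh (c * s) = r * Real.sinh (c * t) := by
  have hs : t / 2 ≤ s := by nlinarith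
  have hs0 : 0 < s := by linarith
  have hρ0 : 0 ≤ ρ := by linarith
  have hS := Real.sinh_pos_iff.2 (mul_pos hc hs0)
  have hT := Real.sinh_pos_iff.2 (mul_pos hc ht)
  refine ⟨Real.sinh (c * s) / Real.sinh (c * t), by positivity, ?_, by field_simp⟩
  have hle : Real.sinh (c * s) ≤ Real.sinh (c * t) := Real.sinh_le_sinh.2 (by gcongr)
  rw [abs_of_nonpos (Real.log_nonpos (by positivity) ((div_le_one hT).2 hle)), ← Real.log_inv,
    inv_div]
  have h3 := sinh_mul_le (mul_pos hc hs0) (show c * s ≤ c * t by gcongr)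
  have h4 : Real.sinh (c * t) / Real.sinh (c * s) ≤ t / s * Real.exp (c * t - c * s) := by
    rw [div_le_iff₀ hS]
    calc Real.sinh (c * t) = Real.sinh (c * t) * (c * s) / (c * s) := by field_simp
      _ ≤ Real.sinh (c * s) * (c * t) * Real.exp (c * t - c * s) / (c * s) := by gcongr
      _ = _ := by field_simp
  refine (Real.log_le_log (by positivity) h4).trans ?_
  rw [Real.log_mul (by positivity) (by positivity), Real.log_exp]
  have h5 := Real.log_le_sub_one_of_pos (show 0 < t / s by positivity)
  have h6 : t / s - 1 ≤ 2 * ρ := by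
    rw [div_sub_one hs0.ne', div_le_iff₀ hs0]
    nlinarith
  have h7 : c * t - c * s ≤ c * ρ := by
    rw [← mul_sub]
    gcongr
  linarith

/-- The discrepancy between the separations is an increment of `log (1 + e^y)`. It is at most
`e^{y'} - e^y`, hence at most both `e^{-R} (y' - y)` and `e^{-R}`. Swapping the points is harmless
because `sinh` is odd. -/
theorem exists_sinh_sep_eq_of_le {c R : ℝ} (hc : 0 < c) (hR : Real.exp (-R) ≤ 1 / 2) {p : ℝ × ℝ}
    (h1 : p.1 ≤ -R) (h2 : p.2 ≤ -R) (hp : p.1 ≠ p.2) :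
    ∃ r, 0 < r ∧ |Real.log r| ≤ (2 + c) * Real.exp (-R) ∧
      Real.sinh (c * sep .cghs p) = r * Real.sinh (c * (p.2 - p.1)) := by
  wlog hlt : p.1 < p.2 generalizing p
  · obtain ⟨r, hr, hr', hr''⟩ := this (p := p.swap) h2 h1 hp.symm
      (lt_of_le_of_ne (not_lt.1 hlt) hp.symm)
    refine ⟨r, hr, hr', ?_⟩
    have e1 : c * sep .cghs p = -(c * sep .cghs p.swap) := by
      simp only [sep, Prod.fst_swap, Prod.snd_swap]
      ring
    have e2 : c * (p.2 - p.1) = -(c * (p.swap.2 - p.swap.1)) := by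
      simp only [Prod.fst_swap, Prod.snd_swap]
      ring
    rw [e1, e2, Real.sinh_neg, Real.sinh_neg, hr'']
    ring
  have ht : 0 < p.2 - p.1 := sub_pos.2 hlt
  have hab : Real.exp p.1 ≤ Real.exp p.2 := Real.exp_le_exp.2 hlt.le
  have hs : p.2 - p.1 - sep .cghs p =
      Real.log (1 + Real.exp p.2) - Real.log (1 + Real.exp p.1) := by
    rw [sep, Model.cghs_x_eq, Model.cghs_x_eq]
    ring
  obtain ⟨h3, h4⟩ := log_one_add_sub_mem (Real.exp_pos p.1) hab
  rw [← hs] at h3 h4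
  have h5 : (Real.exp p.2 - Real.exp p.1) / (1 + Real.exp p.1) ≤ Real.exp p.2 - Real.exp p.1 :=
    div_le_self (sub_nonneg.2 hab) (by linarith [Real.exp_pos p.1])
  have h6 : 0 ≤ (Real.exp p.2 - Real.exp p.1) / (1 + Real.exp p.2) :=
    div_nonneg (sub_nonneg.2 hab) (by positivity)
  have h7 : Real.exp p.2 ≤ Real.exp (-R) := Real.exp_le_exp.2 h2
  have h8 : Real.exp p.2 - Real.exp p.1 ≤ Real.exp (-R) * (p.2 - p.1) := by
    have e : Real.exp p.1 = Real.exp p.2 * Real.exp (p.1 - p.2) := by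
      rw [← Real.exp_add]
      ring_nf
    have h9 := Real.add_one_le_exp (p.1 - p.2)
    calc Real.exp p.2 - Real.exp p.1 = Real.exp p.2 * (1 - Real.exp (p.1 - p.2)) := by
          rw [e]; ring
      _ ≤ Real.exp p.2 * (p.2 - p.1) :=
          mul_le_mul_of_nonneg_left (by linarith) (Real.exp_pos _).le
      _ ≤ _ := by gcongr
  exact exists_sinh_eq hc ht hR (by linarith) (by linarith)
    (by linarith [Real.exp_pos p.1])

/-- By `mul_exp_thermalShift` both sides are the same thermal kernel at two separations, so the
difference is the logarithm of a ratio; no one-variable correction is needed. -/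
theorem norm_kernel_sub_le_of_le {β : ℝ} (hβ : 0 < β) {R : ℝ} (hR : Real.exp (-R) ≤ 1 / 2)
    {p : ℝ × ℝ} (h1 : p.1 ≤ -R) (h2 : p.2 ≤ -R) (hp : p.1 ≠ p.2) :
    ‖Complex.log (sep .cghs p) + (thermalShift β (sep .cghs p) : ℂ) -
      Complex.log (sinhKernel β ((p.2 - p.1 : ℝ) : ℂ)) + (0 + 0)‖ ≤
        (2 + Real.pi / β) * Real.exp (-R) := by
  have hπ := Real.pi_pos
  obtain ⟨r, hr, hr', hs⟩ := exists_sinh_sep_eq_of_le (c := Real.pi / β) (by positivity) hR h1 h2 hp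
  have hs0 : (sep .cghs p : ℂ) ≠ 0 := by exact_mod_cast sep_ne_zero .cghs hp
  have hK : Complex.log (sep .cghs p) + (thermalShift β (sep .cghs p) : ℂ) =
      Complex.log (sinhKernel β (sep .cghs p)) := by
    rw [sinhKernel_ofReal, ← mul_exp_thermalShift hβ, mul_comm, Complex.ofReal_mul,
      Complex.log_ofReal_mul (Real.exp_pos _) hs0, Real.log_exp, add_comm]
  have hne : sinhKernel β ((p.2 - p.1 : ℝ) : ℂ) ≠ 0 := by
    rw [sinhKernel_ofReal]
    have h3 : Real.sinh (Real.pi / β * (p.2 - p.1)) ≠ 0 :=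
      Real.sinh_ne_zero.2 (mul_ne_zero (by positivity) (sub_ne_zero.2 hp.symm))
    exact_mod_cast mul_ne_zero (by positivity) h3
  have hmul : sinhKernel β (sep .cghs p) = (r : ℂ) * sinhKernel β ((p.2 - p.1 : ℝ) : ℂ) := by
    rw [sinhKernel_ofReal, sinhKernel_ofReal, hs, ← Complex.ofReal_mul]
    congr 1
    ring
  rw [hK, hmul, Complex.log_ofReal_mul hr hne, add_sub_cancel_right, add_zero, add_zero,
    Complex.norm_real]
  exact hr'

theorem asympEqAtBot_thermal (t : FieldType) {β : ℝ} (hβ : 0 < β) :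
    AsympEqAtBot (thermalInTwoPt t .cghs β) (thermalOutTwoPt β) := by
  intro ε hε
  obtain ⟨R, hR, hR2, hRε⟩ := exists_exp_neg_le (2 + Real.pi / β) hε
  refine ⟨R, fun f hf h hh hfs hhs => ?_⟩
  have hfa := adapted_of_support_subset_Iic hR hf hfs
  have hha := adapted_of_support_subset_Iic hR hh hhs
  refine ⟨_, _, thermalInTwoPt_integral t hβ hfa hha, thermalOutTwoPt_integral hβ f h, ?_⟩
  refine norm_integral_tensor_sub_le hf hh (hfa.integrable_tensor_mul_thermal hβ hha)
    (by simpa using integrable_tensor_mul_log_sinhKernel hβ f h 0)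
    (fun _ => 0) (fun _ => 0) (by simp) (by simp) ?_
  filter_upwards [ae_ne] with p hp h1 h2
  exact (norm_kernel_sub_le_of_le hβ hR2 (hfs h1) (hhs h2) hp).trans hRε

end Comparison

end BHThermal

end

theorem mainTheorem9 :
    (∀ (t : BHThermal.FieldType) (m : BHThermal.Model) (β : ℝ), 0 < β →
      BHThermal.AsympEqAtTop (BHThermal.thermalInTwoPt t m β)
        (BHThermal.thermalOutTwoPt (2 * Real.pi))) ∧
    (∀ (t : BHThermal.FieldType) (β : ℝ), 0 < β →
      BHThermal.AsympEqAtBot (BHThermal.thermalInTwoPt t BHThermal.Model.cghs β)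
        (BHThermal.thermalOutTwoPt β)) := by
  exact ⟨fun t m _ hβ => BHThermal.asympEqAtTop_thermal t m hβ,
    fun t _ hβ => BHThermal.asympEqAtBot_thermal t hβ⟩
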